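/- Let $M$ and $J$ be finite sets of machines and jobs, let $p_{ij}\in\mathbb Z_{>0}\cup\{\infty\}$ be the processing time of job $j$ on machine $i$, where every job has at least one machine $i$ with $p_{ij}<\infty$, and let $k\ge 1$ be real. For an assignment $\sigma:J\to M$ put $\|\sigma\|_k:=\big(\sum_{i\in M}(\sum_{j\in\sigma^{-1}(i)}p_{ij})^k\big)^{1/k}$, the $L_k$-norm of the machine loads. Let $$g(m,y):=\frac{m\,(1+(1-m)y)^k+(1-m)\,((1-m)y)^k}{m+(1-m)\,y^k},\qquad \alpha:=\sup_{m\in(0,1],\,y\in[0,1]}g(m,y).$$ Then $\alpha<\infty$, and the following randomized rounding algorithm is $\alpha^{1/k}$-approximate for minimizing the $L_k$-norm of machine loads. (1) Let $T:=\sum_{j}\max_{i:\,p_{ij}\neq\infty}p_{ij}$. Take any optimum solution $x$ (one exists) of the time-indexed linear program in the variables $x_{ijs}\in[0,1]$ ($i\in M$, $j\in J$, $s\in\{0,\dots,T-1\}$): minimize $\sum_{i,j,s}\big((s+p_{ij})^k-s^k\big)x_{ijs}$ subject to $\sum_{i,s}x_{ijs}\ge 1$ for every $j$; $\sum_{j}\sum_{s\in(t-p_{ij},\,t]}x_{ijs}\le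 1$ for every $i$ and every $t\in\{0,\dots,T-1\}$; and $x_{ijs}=0$ whenever $s+p_{ij}>T$. Let $x_{ij}:=\sum_s x_{ijs}$. (2) On every machine $i$, order the jobs by non-increasing $p_{ij}$, breaking ties arbitrarily, and let $X_{ij}$ be the sum of $x_{ij'}$ over $j'=j$ and all $j'$ that precede $j$. Machine $i$ has unit-capacity buckets $(i,b)$, $b=0,1,2,\dots$, and $j$ is fractionally matched to $(i,b)$ by the length of $(X_{ij}-x_{ij},X_{ij}]\cap(b,b+1]$. (3) Write this fractional matching as a convex combination of integral matchings, each of which matches every job to exactly one bucket and every bucket to at most one job (this is possible with polynomially many matchings, namely with at most $(|M|+|J|)^2+1$). Sample one of these matchings, with its coefficient as its probability, and assign each job to the machine of its bucket. For every choice of the optimum solution, of the orders and of the convex combination, the resulting random assignment $\tau$ satisfies, for every assignment $\sigma:J\to M$, $$\mathbb E\big[\|\tau\|_k^k\big]\le\alpha\,\|\sigma\|_k^k\qquad\text{and}\qquad \mathbb E\big[\|\tau\|_k\big]\le\alpha^{1/k}\,\|\sigma\|_k .$$ -/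

import Mathlib

open scoped NNReal ENNReal

noncomputable section

namespace LkSched

/-- The function whose supremum over `m ∈ (0,1]`, `y ∈ [0,1]` is the `k`-th power of the ratio. -/
def g (k m y : ℝ) : ℝ :=
  (m * (1 + (1 - m) * y) ^ k + (1 - m) * ((1 - m) * y) ^ k) / (m * 1 ^ k + (1 - m) * y ^ k)

/-- The set of all values `g k m y` with `m ∈ (0,1]` and `y ∈ [0,1]`. -/
def gValues (k : ℝ) : Set ℝ :=
  {v | ∃ m ∈ Set.Ioc (0 : ℝ) 1, ∃ y ∈ Set.Icc (0 : ℝ) 1, v = g k m y}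

/-- `α = sup g(m, y)`. -/
def alpha (k : ℝ) : ℝ := sSup (gValues k)

variable {M J : Type*} [Fintype M] [DecidableEq M] [Fintype J] [DecidableEq J]

/-! An instance is a matrix `p i j : ℕ∞` of processing times (`⊤`: job `j` may not be put on
machine `i`). -/

/-- The load of machine `i` under the assignment `σ`. -/
def load (p : M → J → ℕ∞) (σ : J → M) (i : M) : ℝ≥0∞ :=
  ∑ j with σ j = i, (p i j : ℝ≥0∞)

/-- The `L_k`-norm of the machine loads. -/
def lkNorm (k : ℝ) (p : M → J → ℕ∞) (σ : J → M) : ℝ≥0∞ :=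
  (∑ i, load p σ i ^ k) ^ (1 / k)

/-- The time horizon `T = ∑ j, max {p i j | p i j ≠ ⊤}` (note that `ENat.toNat ⊤ = 0`). -/
def horizon (p : M → J → ℕ∞) : ℕ :=
  ∑ j, Finset.univ.sup fun i => (p i j).toNat

/-- Feasibility for the time-indexed LP; `x i j s` is the variable for starting job `j` on
machine `i` at time `s ∈ {0, …, T - 1}`. A job started at `s` occupies the times `t` with
`s ≤ t < s + p i j`. When all `p i j` are positive, the constraint `not_late` makes `x` vanish
outside `{0, …, T - 1}`, and on all pairs with `p i j = ⊤`. -/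
structure IsLPFeasible (p : M → J → ℕ∞) (x : M → J → ℕ → ℝ) : Prop where
  mem_Icc : ∀ i j s, x i j s ∈ Set.Icc (0 : ℝ) 1
  covered : ∀ j, 1 ≤ ∑ i, ∑ s ∈ Finset.range (horizon p), x i j s
  capacity : ∀ i, ∀ t ∈ Finset.range (horizon p),
    ∑ j, ∑ s ∈ Finset.range (horizon p) with s ≤ t ∧ (t : ℕ∞) < s + p i j, x i j s ≤ 1
  not_late : ∀ i j (s : ℕ), (horizon p : ℕ∞) < s + p i j → x i j s = 0

/-- The LP objective, with coefficients `(s + p i j) ^ k - s ^ k`. (Pairs with `p i j = ⊤` have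
`x i j s = 0` in every feasible solution and do not contribute.) -/
def lpCost (k : ℝ) (p : M → J → ℕ∞) (x : M → J → ℕ → ℝ) : ℝ :=
  ∑ j, ∑ i, ∑ s ∈ Finset.range (horizon p),
    (((s : ℝ) + ((p i j).toNat : ℝ)) ^ k - (s : ℝ) ^ k) * x i j s

/-- `x` is an optimum solution of the time-indexed LP. -/
def IsLPOptimal (k : ℝ) (p : M → J → ℕ∞) (x : M → J → ℕ → ℝ) : Prop :=
  IsLPFeasible p x ∧ ∀ x', IsLPFeasible p x' → lpCost k p x ≤ lpCost k p x'

/-- The fraction `x_{ij} = ∑ s, x_{ijs}` of job `j` that is put on machine `i`. -/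
def frac (p : M → J → ℕ∞) (x : M → J → ℕ → ℝ) (i : M) (j : J) : ℝ :=
  ∑ s ∈ Finset.range (horizon p), x i j s

/-- On every machine `i`, the enumeration `ord i` lists the jobs in non-increasing order of their
processing times on `i`; ties are broken in an arbitrary but fixed way. -/
def IsSizeOrder (p : M → J → ℕ∞) (ord : M → J ≃ Fin (Fintype.card J)) : Prop :=
  ∀ i j j', p i j' < p i j → ord i j < ord i j'

/-- `X_{ij}`: the total fraction on machine `i` of `j` and of the jobs that precede it. -/
def prefixFrac (p : M → J → ℕ∞) (x : M → J → ℕ → ℝ) (ord : M → J ≃ Fin (Fintype.card J))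
    (i : M) (j : J) : ℝ :=
  ∑ j' with ord i j' ≤ ord i j, frac p x i j'

/-- The fractional matching between jobs and unit-capacity buckets. Job `j` occupies the interval
`(X_{ij} - x_{ij}, X_{ij}]` of machine `i`; the bucket `(i, b)`, `b = 0, 1, 2, …`, is the interval
`(b, b + 1]`; `j` is matched to `(i, b)` by the length of the intersection. -/
def bucketMatching (p : M → J → ℕ∞) (x : M → J → ℕ → ℝ) (ord : M → J ≃ Fin (Fintype.card J))
    (j : J) (i : M) (b : ℕ) : ℝ :=
  max 0 (min (prefixFrac p x ord i j) ((b : ℝ) + 1)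
    - max (prefixFrac p x ord i j - frac p x i j) (b : ℝ))

/-- The matchings `μ a`, `a < r`, with weights `c a`, form a decomposition of the fractional
matching `y` into a convex combination of integral matchings: every `μ a` sends each job to one
bucket and no two jobs to the same bucket, and the total weight of the matchings that send `j` to
the bucket `(i, b)` is `y j i b`. (A bucket that gets no job is one filled by a dummy job of
size zero.) -/
structure IsMatchingDecomposition (y : J → M → ℕ → ℝ) {r : ℕ} (c : Fin r → ℝ≥0)
    (μ : Fin r → J → M × ℕ) : Prop where
  sum_eq_one : ∑ a, c a = 1
  injective : ∀ a, Function.Injective (μ a)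
  marginal : ∀ j i b, ∑ a with μ a j = (i, b), (c a : ℝ) = y j i b

/-- The assignment of jobs to machines that a matching of jobs to buckets gives. -/
def toAssignment (τ : J → M × ℕ) : J → M := fun j => (τ j).1

/-- The expectation of `Z` at the output of the rounding, which picks `μ a` with probability
`c a`. -/
def expectation {r : ℕ} (c : Fin r → ℝ≥0) (μ : Fin r → J → M × ℕ) (Z : (J → M) → ℝ≥0∞) : ℝ≥0∞ :=
  ∑ a, (c a : ℝ≥0∞) * Z (toAssignment (μ a))

end LkSched

end

namespace LkSched

/-! ### The ratio `α` -/

/-! The comparison is made on one machine at a time: the expected `k`-th power of its load is at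
most `α` times its share of the LP cost. Summing over machines gives the first bound, because the
jobs of any finite-norm `σ`, run one after another on each machine, form an LP solution of cost
`‖σ‖_k^k`. The second bound follows by Jensen.

Both sides on a machine are compared with a profile, a probability distribution on sizes. By LP
duality there is a level `n` such that the jobs longer than `n` have mass `m < 1`, and the LP pays
at least as much as if these jobs ran alone with their fractions while all shorter ones were smeared
into one size `Y ∈ [n, n + 1]` of mass `1 - m` and equal volume (`exists_machine_lower_bound`). So
the LP cost is at least the `k`-th moment of the profile.

For the rounding, split the load into the part `L` from bucket 0 and the rest `R`. Let `C` be the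
sum of the maximal sizes of the later buckets. Sorting by size gives `R ≤ C ≤ L + R` for every
matching that can be drawn. Convexity then bounds `(L + R)^k` by `H L + l * (R - C)`, with `H`
affine up to some threshold (`exists_load_certificate`). The expectation of this bound depends only
on the marginals, hence no independence is needed, and it equals `∑ w * H v - l * C` for the
profile.

That quantity is the `k`-th moment after shifting the top part of the profile by `C` and replacing
the bottom part, whose integral is `C`, by the constant `C`. Smearing the bottom part to its mean
reduces the comparison with the original moment to two-point distributions, whose worst case is `α`
(`profile_sum_le`). -/

theorem g_le {k m y : ℝ} (hk : 1 ≤ k) (hm : m ∈ Set.Ioc (0 : ℝ) 1) (hy : y ∈ Set.Icc (0 : ℝ) 1) :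
    g k m y ≤ 2 ^ k := by
  obtain ⟨hm0, hm1⟩ := hm
  obtain ⟨hy0, hy1⟩ := hy
  have hk0 : 0 ≤ k := by linarith
  have hyk : 0 ≤ y ^ k := Real.rpow_nonneg hy0 k
  have h1m : 0 ≤ 1 - m := by linarith
  have h2 : (1 : ℝ) ≤ 2 ^ k := Real.one_le_rpow (by norm_num) hk0
  unfold g
  rw [Real.one_rpow, div_le_iff₀ (by nlinarith [mul_nonneg h1m hyk])]
  have e1 : (1 + (1 - m) * y) ^ k ≤ 2 ^ k :=
    Real.rpow_le_rpow (by nlinarith [mul_nonneg h1m hy0]) (by nlinarith) hk0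
  have e2 : ((1 - m) * y) ^ k ≤ y ^ k :=
    Real.rpow_le_rpow (mul_nonneg h1m hy0) (by nlinarith) hk0
  have e3 : y ^ k ≤ 2 ^ k * y ^ k := le_mul_of_one_le_left hyk h2
  nlinarith [mul_le_mul_of_nonneg_left e1 hm0.le,
    mul_le_mul_of_nonneg_left (e2.trans e3) h1m]

theorem bddAbove_gValues {k : ℝ} (hk : 1 ≤ k) : BddAbove (gValues k) := by
  refine ⟨2 ^ k, ?_⟩
  rintro v ⟨m, hm, y, hy, rfl⟩
  exact g_le hk hm hy

theorem g_le_alpha {k m y : ℝ} (hk : 1 ≤ k) (hm : m ∈ Set.Ioc (0 : ℝ) 1)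
    (hy : y ∈ Set.Icc (0 : ℝ) 1) : g k m y ≤ alpha k :=
  le_csSup (bddAbove_gValues hk) ⟨m, hm, y, hy, rfl⟩

theorem one_le_alpha {k : ℝ} (hk : 1 ≤ k) : 1 ≤ alpha k := by
  have h := g_le_alpha (k := k) (m := 1) (y := 0) hk ⟨by norm_num, le_rfl⟩ ⟨le_rfl, by norm_num⟩
  simpa [g] using h

/-- The defining inequality of `α`, in homogeneous form. -/
theorem two_point_le {k m P y : ℝ} (hk : 1 ≤ k) (hm0 : 0 ≤ m) (hm1 : m ≤ 1) (hy : 0 ≤ y)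
    (hyP : y ≤ P) :
    m * (P + (1 - m) * y) ^ k + (1 - m) * ((1 - m) * y) ^ k
      ≤ alpha k * (m * P ^ k + (1 - m) * y ^ k) := by
  have hα := one_le_alpha hk
  have hk0 : 0 < k := by linarith
  have h1m : 0 ≤ 1 - m := by linarith
  -- The supremum leaves out `m = 0`, where the inequality follows from `1 ≤ alpha k`.
  rcases hm0.eq_or_lt with rfl | hm0
  · have := Real.rpow_nonneg hy k
    simp only [sub_zero, zero_mul, one_mul, zero_add]
    nlinarith
  rcases (hy.trans hyP).eq_or_lt with rfl | hP
  · obtain rfl : y = 0 := le_antisymm hyP hy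
    simp [Real.zero_rpow hk0.ne']
  have hg := g_le_alpha hk ⟨hm0, hm1⟩ (y := y / P) ⟨by positivity, (div_le_one hP).2 hyP⟩
  have hz : 0 ≤ y / P := by positivity
  have hyz : y = P * (y / P) := by field_simp
  generalize y / P = z at hg hz hyz
  subst hyz
  have hzk : 0 ≤ z ^ k := Real.rpow_nonneg hz k
  have hPk : 0 ≤ P ^ k := Real.rpow_nonneg hP.le k
  unfold g at hg
  rw [Real.one_rpow, div_le_iff₀ (by nlinarith [mul_nonneg h1m hzk])] at hg
  have e1 : (P + (1 - m) * (P * z)) ^ k = P ^ k * (1 + (1 - m) * z) ^ k := by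
    rw [← Real.mul_rpow hP.le (by positivity)]; congr 1; ring
  have e2 : ((1 - m) * (P * z)) ^ k = P ^ k * ((1 - m) * z) ^ k := by
    rw [← Real.mul_rpow hP.le (by positivity)]; congr 1; ring
  have e3 : (P * z) ^ k = P ^ k * z ^ k := Real.mul_rpow hP.le hz
  rw [e1, e2, e3]
  nlinarith [mul_le_mul_of_nonneg_left hg hPk]

/-! ### Profiles -/

/-- A finite distribution can be cut at a threshold such that the part below has a prescribed
integral; atoms at the threshold may be cut into two. -/
theorem exists_threshold {ι : Type*} [Fintype ι] [Nonempty ι] {w v : ι → ℝ}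
    (hw : ∀ a, 0 ≤ w a) (hv : ∀ a, 0 ≤ v a) {c : ℝ} (hc0 : 0 ≤ c) (hc : c ≤ ∑ a, w a * v a) :
    ∃ a₀, ∃ θ : ι → ℝ, (∀ a, 0 ≤ θ a) ∧ (∀ a, θ a ≤ 1) ∧ (∀ a, 0 < θ a → v a₀ ≤ v a) ∧
      (∀ a, θ a < 1 → v a ≤ v a₀) ∧ ∑ a, w a * (1 - θ a) * v a = c := by
  classical
  -- `N t` is the integral of the part with values at most `t`. The threshold is the smallest value
  -- where `N` reaches `c`; its atoms contribute `B`, and the part strictly below contributes `A ≤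
  -- c`.
  let N : ℝ → ℝ := fun t => ∑ a with v a ≤ t, w a * v a
  have hne : (Finset.univ.filter fun a => c ≤ N (v a)).Nonempty := by
    obtain ⟨a, -, ha⟩ := Finset.exists_max_image Finset.univ v Finset.univ_nonempty
    refine ⟨a, Finset.mem_filter.2 ⟨Finset.mem_univ _, ?_⟩⟩
    simpa [N, Finset.filter_true_of_mem fun b hb => ha b hb] using hc
  obtain ⟨a₀, ha₀, hmin⟩ := Finset.exists_min_image _ v hne
  have ha₀ : c ≤ N (v a₀) := (Finset.mem_filter.1 ha₀).2
  set A := ∑ a with v a < v a₀, w a * v a with hA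
  set B := ∑ a with v a = v a₀, w a * v a with hB
  have hN : N (v a₀) = A + B := by
    simp only [N, hA, hB]
    rw [← Finset.sum_union]
    · congr 1; ext a; simp [le_iff_lt_or_eq]
    · rw [Finset.disjoint_filter]; intro a _ h1 h2; exact h1.ne h2
  have hB0 : 0 ≤ B := Finset.sum_nonneg fun a _ => mul_nonneg (hw a) (hv a)
  have hAc : A ≤ c := by
    by_cases hs : (Finset.univ.filter fun a => v a < v a₀).Nonempty
    · obtain ⟨a, ha, hmax⟩ := Finset.exists_max_image _ v hs
      have ha : v a < v a₀ := (Finset.mem_filter.1 ha).2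
      have hAN : A = N (v a) := by
        simp only [N, hA]; congr 1; ext b; simp only [Finset.mem_filter, Finset.mem_univ, true_and]
        exact ⟨fun h => hmax b (by simpa using h), fun h => h.trans_lt ha⟩
      by_contra hcon
      have := hmin a (by simp only [Finset.mem_filter, Finset.mem_univ, true_and]; linarith)
      linarith
    · rw [hA, Finset.not_nonempty_iff_eq_empty.1 hs]; simpa using hc0
  obtain ⟨η, hη0, hη1, hη⟩ : ∃ η : ℝ, 0 ≤ η ∧ η ≤ 1 ∧ A + η * B = c := by
    rcases hB0.eq_or_lt with h | h
    · exact ⟨0, le_rfl, zero_le_one, by linarith⟩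
    · refine ⟨(c - A) / B, div_nonneg (by linarith) h.le, (div_le_one h).2 (by linarith), ?_⟩
      field_simp; ring
  refine ⟨a₀, fun a => if v a < v a₀ then 0 else if v a = v a₀ then 1 - η else 1,
    ?_, ?_, ?_, ?_, ?_⟩
  · intro a; dsimp only; split_ifs <;> linarith
  · intro a; dsimp only; split_ifs <;> linarith
  · intro a; dsimp only; split_ifs with h1 h2
    · simp
    · intro _; exact h2.ge
    · intro _; exact not_lt.1 h1
  · intro a; dsimp only; split_ifs with h1 h2
    · intro _; exact h1.le
    · intro _; exact h2.le
    · simp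
  · rw [← hη, hA, hB, Finset.mul_sum, Finset.sum_filter, Finset.sum_filter,
      ← Finset.sum_add_distrib]
    refine Finset.sum_congr rfl fun a _ => ?_
    rcases lt_trichotomy (v a) (v a₀) with h | h | h
    · simp [h, h.ne]
    · simp [h]; ring
    · simp [h.ne', h.not_gt]

/-- Replacing the lower part by its mean `y` keeps its integral `c` and only lowers its `k`-th
moment (Jensen). Each value of the upper part then forms, with `y`, a two-point distribution to
which the definition of `α` applies. -/
theorem profile_sum_le {ι : Type*} [Fintype ι] {k : ℝ} (hk : 1 ≤ k) {w v θ : ι → ℝ}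
    (hw : ∀ a, 0 ≤ w a) (hv : ∀ a, 0 ≤ v a) (hw1 : ∑ a, w a = 1) (hθ0 : ∀ a, 0 ≤ θ a)
    (hθ1 : ∀ a, θ a ≤ 1) {P c : ℝ} (hP : ∀ a, 0 < θ a → P ≤ v a) (hP' : ∀ a, θ a < 1 → v a ≤ P)
    (hc : ∑ a, w a * (1 - θ a) * v a = c) :
    ∑ a, w a * θ a * (v a + c) ^ k + (1 - ∑ a, w a * θ a) * c ^ k
      ≤ alpha k * ∑ a, w a * v a ^ k := by
  have hk0 : 0 < k := by linarith
  have hα := one_le_alpha hk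
  set m := ∑ a, w a * θ a with hm
  have hm0 : 0 ≤ m := Finset.sum_nonneg fun a _ => mul_nonneg (hw a) (hθ0 a)
  have h1m : 1 - m = ∑ a, w a * (1 - θ a) := by
    conv_lhs => rw [← hw1, hm, ← Finset.sum_sub_distrib]
    exact Finset.sum_congr rfl fun a _ => by ring
  have hu0 : ∀ a, 0 ≤ w a * (1 - θ a) := fun a => mul_nonneg (hw a) (by linarith [hθ1 a])
  have h1m0 : 0 ≤ 1 - m := h1m ▸ Finset.sum_nonneg fun a _ => hu0 a
  obtain ⟨y, hy0, hyc, hyP, hyk⟩ : ∃ y : ℝ, 0 ≤ y ∧ c = (1 - m) * y ∧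
      (∀ a, 0 < θ a → y ≤ v a) ∧ (1 - m) * y ^ k ≤ ∑ a, w a * (1 - θ a) * v a ^ k := by
    rcases h1m0.eq_or_lt with h | h
    · have hz : ∀ a, w a * (1 - θ a) = 0 := fun a =>
        (Finset.sum_eq_zero_iff_of_nonneg fun a _ => hu0 a).1 (h1m.symm.trans h.symm) a
          (Finset.mem_univ _)
      refine ⟨0, le_rfl, ?_, fun a _ => hv a, ?_⟩
      · rw [← hc]; simp [hz]
      · simp [hz, ← h]
    · have hc0 : 0 ≤ c := hc ▸ Finset.sum_nonneg fun a _ => mul_nonneg (hu0 a) (hv a)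
      refine ⟨c / (1 - m), by positivity, by field_simp, fun a ha => ?_, ?_⟩
      · refine le_trans ?_ (hP a ha)
        rw [div_le_iff₀ h, ← hc, h1m, Finset.mul_sum]
        refine Finset.sum_le_sum fun b _ => ?_
        rcases (hθ1 b).eq_or_lt with hb | hb
        · simp [hb]
        · rw [mul_comm P]; exact mul_le_mul_of_nonneg_left (hP' b hb) (hu0 b)
      · have hJ := Real.rpow_arith_mean_le_arith_mean_rpow Finset.univ
          (fun a => w a * (1 - θ a) / (1 - m)) v (fun a _ => div_nonneg (hu0 a) h.le)
          (by rw [← Finset.sum_div, ← h1m, div_self h.ne']) (fun a _ => hv a) hk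
        have e1 : ∑ a, w a * (1 - θ a) / (1 - m) * v a = c / (1 - m) := by
          rw [← hc, Finset.sum_div]; exact Finset.sum_congr rfl fun a _ => by ring
        have e2 : ∑ a, w a * (1 - θ a) / (1 - m) * v a ^ k
            = (∑ a, w a * (1 - θ a) * v a ^ k) / (1 - m) := by
          rw [Finset.sum_div]; exact Finset.sum_congr rfl fun a _ => by ring
        rw [e1, e2, le_div_iff₀ h] at hJ
        linarith
  have hsplit : ∑ a, w a * v a ^ k
      = ∑ a, w a * θ a * v a ^ k + ∑ a, w a * (1 - θ a) * v a ^ k := by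
    rw [← Finset.sum_add_distrib]; exact Finset.sum_congr rfl fun a _ => by ring
  have hgoal : ∑ a, w a * θ a * (v a + c) ^ k + (1 - m) * c ^ k
      ≤ alpha k * (∑ a, w a * θ a * v a ^ k + (1 - m) * y ^ k) := by
    rcases hm0.eq_or_lt with h | h
    · have hz : ∀ a, w a * θ a = 0 := fun a =>
        (Finset.sum_eq_zero_iff_of_nonneg fun a _ => mul_nonneg (hw a) (hθ0 a)).1
          (hm.symm.trans h.symm) a (Finset.mem_univ _)
      have := two_point_le hk hm0 (by linarith) hy0 le_rfl
      rw [← h] at this hyc ⊢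
      simp only [hz, zero_mul, Finset.sum_const_zero, zero_add, hyc]
      simpa using this
    -- The two-point inequality, averaged over the upper part with weights `w a * θ a`. These sum to
    -- `m`, so a common factor `m` cancels.
    · have key : ∑ a, w a * θ a * (m * (v a + c) ^ k + (1 - m) * c ^ k)
          ≤ ∑ a, w a * θ a * (alpha k * (m * v a ^ k + (1 - m) * y ^ k)) := by
        refine Finset.sum_le_sum fun a _ => ?_
        rcases (hθ0 a).eq_or_lt with ha | ha
        · simp [← ha]
        · refine mul_le_mul_of_nonneg_left ?_ (mul_nonneg (hw a) (hθ0 a))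
          rw [hyc]; exact two_point_le hk hm0 (by linarith) hy0 (hyP a ha)
      have e1 : ∑ a, w a * θ a * (m * (v a + c) ^ k + (1 - m) * c ^ k)
          = m * (∑ a, w a * θ a * (v a + c) ^ k + (1 - m) * c ^ k) := by
        have : m * ((1 - m) * c ^ k) = ∑ a, w a * θ a * ((1 - m) * c ^ k) := by
          rw [hm, Finset.sum_mul]
        rw [mul_add, this, Finset.mul_sum, ← Finset.sum_add_distrib]
        exact Finset.sum_congr rfl fun a _ => by ring
      have e2 : ∑ a, w a * θ a * (alpha k * (m * v a ^ k + (1 - m) * y ^ k))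
          = m * (alpha k * (∑ a, w a * θ a * v a ^ k + (1 - m) * y ^ k)) := by
        have : m * (alpha k * ((1 - m) * y ^ k))
            = ∑ a, w a * θ a * (alpha k * ((1 - m) * y ^ k)) := by
          rw [hm, Finset.sum_mul]
        rw [mul_add (alpha k), mul_add m, this, Finset.mul_sum, Finset.mul_sum,
          ← Finset.sum_add_distrib]
        exact Finset.sum_congr rfl fun a _ => by ring
      rw [e1, e2] at key
      exact le_of_mul_le_mul_left key h
  rw [hsplit]
  exact hgoal.trans (mul_le_mul_of_nonneg_left (by linarith) (by linarith))

/-- The slope of the chord of `x ^ k` over `[c, c + P]`. -/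
theorem exists_chord {k : ℝ} (hk : 1 ≤ k) {c P : ℝ} (hc : 0 ≤ c) (hP : 0 ≤ P) :
    ∃ l : ℝ, (c + P) ^ k = c ^ k + l * P ∧
      (∀ z, c ≤ z → z ≤ c + P → z ^ k ≤ c ^ k + l * (z - c)) ∧
      ∀ z z', c ≤ z → z ≤ z' → c + P ≤ z' → z ^ k ≤ z' ^ k + l * (z - z') := by
  have hk0 : 0 ≤ k := by linarith
  have hcv := convexOn_rpow hk
  rcases hP.eq_or_lt with rfl | hP
  · refine ⟨0, by simp, fun z h1 h2 => ?_, fun z z' h1 h2 h3 => ?_⟩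
    · obtain rfl : z = c := by linarith
      simp
    · simpa using Real.rpow_le_rpow (hc.trans h1) h2 hk0
  have hcP : c + P ∈ Set.Ici (0 : ℝ) := by simp only [Set.mem_Ici]; linarith
  refine ⟨((c + P) ^ k - c ^ k) / P, by field_simp; ring, fun z h1 h2 => ?_,
    fun z z' h1 h2 h3 => ?_⟩
  · rcases h1.eq_or_lt with rfl | h1
    · simp
    have := hcv.secant_mono (a := c) (x := z) (y := c + P) hc (hc.trans h1.le) hcP h1.ne'
      (by linarith) h2
    rw [add_sub_cancel_left, div_le_iff₀ (by linarith)] at this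
    linarith
  · rcases h2.eq_or_lt with rfl | h2
    · simp
    have hz' : z' ∈ Set.Ici (0 : ℝ) := by simp only [Set.mem_Ici]; linarith
    -- Slopes of chords increase from `[c, c + P]` to `[c, z']` and on to `[z, z']`.
    have t1 := hcv.secant_mono (a := c) (x := c + P) (y := z') hc hcP hz' (by linarith)
      (by linarith) h3
    have t2 := hcv.secant_mono (a := z') (x := c) (y := z) hz' hc (hc.trans h1) (by linarith)
      h2.ne h1
    simp only [add_sub_cancel_left] at t1
    rw [← neg_div_neg_eq, ← neg_div_neg_eq (_ - _) (z - z'), neg_sub, neg_sub, neg_sub, neg_sub]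
      at t2
    have t := t1.trans t2
    rw [le_div_iff₀ (by linarith)] at t
    linarith

/-! ### Telescoping along an order -/

/-- Needed for two choices of `φ`: the power `z ^ k` for the cost of a schedule, and the clamp to
`[b, b + 1]` for the filling of a bucket. -/
theorem sum_prefix_telescope {ι α : Type*} [DecidableEq ι] [LinearOrder α] {e : ι → α}
    (he : Function.Injective e) (w : ι → ℝ) (φ : ℝ → ℝ) (s : Finset ι) :
    ∑ j ∈ s, (φ (∑ j' ∈ s with e j' ≤ e j, w j') - φ (∑ j' ∈ s with e j' ≤ e j, w j' - w j))
      = φ (∑ j ∈ s, w j) - φ 0 := by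
  induction s using Finset.induction_on_max_value e with
  | empty => simp
  | insert a s has hmax ih =>
    have h1 : (insert a s).filter (fun j' => e j' ≤ e a) = insert a s :=
      Finset.filter_true_of_mem fun j hj => by
        rcases Finset.mem_insert.1 hj with rfl | hj
        · exact le_rfl
        · exact hmax j hj
    have h2 : ∀ j ∈ s, (insert a s).filter (fun j' => e j' ≤ e j)
        = s.filter (fun j' => e j' ≤ e j) := fun j hj => by
      rw [Finset.filter_insert, if_neg]
      intro h
      exact has (he ((hmax j hj).antisymm h) ▸ hj)
    have h3 : ∀ j ∈ s, φ (∑ j' ∈ insert a s with e j' ≤ e j, w j')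
        - φ (∑ j' ∈ insert a s with e j' ≤ e j, w j' - w j)
        = φ (∑ j' ∈ s with e j' ≤ e j, w j') - φ (∑ j' ∈ s with e j' ≤ e j, w j' - w j) :=
      fun j hj => by rw [h2 j hj]
    rw [Finset.sum_insert has, h1, Finset.sum_congr rfl h3, ih,
      Finset.sum_insert has, add_sub_cancel_left]
    ring

/-! ### The lower bound that the LP gives on one machine -/

theorem rpow_increment_mono {k : ℝ} (hk : 1 ≤ k) :
    Monotone fun t : ℕ => ((t : ℝ) + 1) ^ k - (t : ℝ) ^ k := by
  refine monotone_nat_of_le_succ fun t => ?_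
  have h := (convexOn_rpow hk).2 (show (t : ℝ) ∈ Set.Ici 0 by simp)
    (show (t : ℝ) + 1 + 1 ∈ Set.Ici 0 by simp only [Set.mem_Ici]; positivity)
    (show (0 : ℝ) ≤ 1 / 2 by norm_num) (show (0 : ℝ) ≤ 1 / 2 by norm_num) (by norm_num)
  simp only [smul_eq_mul] at h
  rw [show (1 / 2 : ℝ) * t + 1 / 2 * (t + 1 + 1) = t + 1 by ring] at h
  push_cast
  linarith

theorem rpow_chord_nat {k : ℝ} (hk : 1 ≤ k) {n : ℕ} {y : ℝ} (h1 : (n : ℝ) ≤ y)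
    (h2 : y ≤ n + 1) :
    y ^ k ≤ (n : ℝ) ^ k + (((n : ℝ) + 1) ^ k - (n : ℝ) ^ k) * (y - n) := by
  have h := (convexOn_rpow hk).2 (show (n : ℝ) ∈ Set.Ici 0 by simp)
    (show (n : ℝ) + 1 ∈ Set.Ici 0 by simp only [Set.mem_Ici]; positivity)
    (show 0 ≤ n + 1 - y by linarith) (show 0 ≤ y - n by linarith) (by ring)
  simp only [smul_eq_mul] at h
  rw [show (n + 1 - y) * (n : ℝ) + (y - n) * (n + 1) = y by ring] at h
  linarith

/-- The critical level `n`: below it jobs can be stacked to fill the machine, above it jobs can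
all be started at time `0`. -/
theorem exists_level {J : Type*} [Fintype J] {X : J → ℝ} (hX : ∀ j, 0 ≤ X j) (q : J → ℕ) :
    ∃ n : ℕ, (n : ℝ) ≤ ∑ j, X j * (min (q j) n : ℕ) ∧
      ∑ j, X j * (min (q j) (n + 1) : ℕ) < (n : ℝ) + 1 := by
  by_contra! hcon
  -- Without a critical level the truncated volume would be at least `n` for every `n`, but it never
  -- exceeds the full volume.
  have hall : ∀ n : ℕ, (n : ℝ) ≤ ∑ j, X j * (min (q j) n : ℕ) := by
    intro n
    induction n with
    | zero => simp
    | succ n ih => exact_mod_cast hcon n ih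
  obtain ⟨N, hN⟩ := exists_nat_gt (∑ j, X j * q j)
  refine absurd (hall N) (not_le.2 (lt_of_le_of_lt ?_ hN))
  gcongr with j _
  · exact hX j
  · exact min_le_left _ _

theorem sum_rpow_increment (k : ℝ) (s q : ℕ) :
    ∑ r ∈ Finset.range q, ((((s + r : ℕ) : ℝ) + 1) ^ k - ((s + r : ℕ) : ℝ) ^ k)
      = ((s : ℝ) + q) ^ k - (s : ℝ) ^ k := by
  have := Finset.sum_range_sub (fun r => (((s + r : ℕ) : ℝ)) ^ k) q
  push_cast at this ⊢
  simpa [add_assoc] using this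

/-- Lower bound on the cost of a fractional time-indexed schedule of one machine whose jobs have
sizes `q j`, given by the mass of long jobs and the volume of short ones. -/
theorem exists_machine_lower_bound {J : Type*} [Fintype J] {k : ℝ} (hk : 1 ≤ k) (T : ℕ)
    (q : J → ℕ) {x : J → ℕ → ℝ} (hx : ∀ j s, 0 ≤ x j s)
    (hcap : ∀ t : ℕ, ∑ j, ∑ s ∈ Finset.range T with s ≤ t ∧ t < s + q j, x j s ≤ 1) {X : J → ℝ}
    (hX : ∀ j, X j = ∑ s ∈ Finset.range T, x j s) :
    ∃ (n : ℕ) (y : ℝ), (n : ℝ) ≤ y ∧ y ≤ n + 1 ∧ ∑ j with n < q j, X j < 1 ∧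
      (1 - ∑ j with n < q j, X j) * y = ∑ j with ¬ n < q j, X j * q j ∧
      ∑ j with n < q j, X j * (q j : ℝ) ^ k + (1 - ∑ j with n < q j, X j) * y ^ k
        ≤ ∑ j, ∑ s ∈ Finset.range T, (((s : ℝ) + q j) ^ k - (s : ℝ) ^ k) * x j s := by
  have hk0 : 0 < k := by linarith
  have hX0 : ∀ j, 0 ≤ X j := fun j => hX j ▸ Finset.sum_nonneg fun s _ => hx j s
  obtain ⟨n, hn1, hn2⟩ := exists_level hX0 q
  set m := ∑ j with n < q j, X j with hm
  set v := ∑ j with ¬ n < q j, X j * q j with hv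
  have hv0 : 0 ≤ v := Finset.sum_nonneg fun j _ => mul_nonneg (hX0 j) (Nat.cast_nonneg _)
  have hS1 : ∑ j, X j * (min (q j) n : ℕ) = m * n + v := by
    rw [hm, hv, Finset.sum_mul, ← Finset.sum_filter_add_sum_filter_not Finset.univ
      (fun j => n < q j)]
    congr 1 <;> refine Finset.sum_congr rfl fun j hj => ?_
    · rw [min_eq_right (Finset.mem_filter.1 hj).2.le]
    · rw [min_eq_left (not_lt.1 (Finset.mem_filter.1 hj).2)]
  have hS2 : ∑ j, X j * (min (q j) (n + 1) : ℕ) = m * (n + 1) + v := by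
    rw [hm, hv, Finset.sum_mul, ← Finset.sum_filter_add_sum_filter_not Finset.univ
      (fun j => n < q j)]
    congr 1 <;> refine Finset.sum_congr rfl fun j hj => ?_
    · rw [min_eq_right (Nat.succ_le_of_lt (Finset.mem_filter.1 hj).2)]; push_cast; rfl
    · rw [min_eq_left ((not_lt.1 (Finset.mem_filter.1 hj).2).trans (Nat.le_succ n))]
  rw [hS1] at hn1
  rw [hS2] at hn2
  have hn0 : (0 : ℝ) ≤ n := Nat.cast_nonneg n
  have hm1 : m < 1 := by nlinarith
  have h1m : 0 < 1 - m := by linarith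
  have hvy : (1 - m) * (v / (1 - m)) = v := by field_simp
  have hyn : (n : ℝ) ≤ v / (1 - m) := by rw [le_div_iff₀ h1m]; linarith
  have hyn1 : v / (1 - m) ≤ n + 1 := by rw [div_le_iff₀ h1m]; linarith
  refine ⟨n, v / (1 - m), hyn, hyn1, hm1, hvy, ?_⟩
  set y := v / (1 - m)
  let w : ℕ → ℝ := fun t => ((t : ℝ) + 1) ^ k - (t : ℝ) ^ k
  have hw : Monotone w := rpow_increment_mono hk
  -- Dual solution: `D t` is the price of time `t`, which lifts the marginal cost `w t` to at least
  -- `w n`; `A q` is the value of a job of size `q`. Dual feasibility is `hterm`, and total prices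
  -- are bounded through the capacities in `hocc`.
  let D : ℕ → ℝ := fun t => max (w t) (w n) - w t
  have hD0 : ∀ t, 0 ≤ D t := fun t => sub_nonneg.2 (le_max_left _ _)
  have hDn : ∀ t, n ≤ t → D t = 0 := fun t ht => by simp [D, hw ht]
  have hsumw : ∀ q : ℕ, ∑ r ∈ Finset.range q, w r = (q : ℝ) ^ k := fun q => by
    simpa only [zero_add, Nat.cast_zero, Real.zero_rpow hk0.ne', sub_zero]
      using sum_rpow_increment k 0 q
  let A : ℕ → ℝ := fun q => ∑ r ∈ Finset.range q, max (w r) (w n)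
  have hA1 : ∀ q, q ≤ n → A q = w n * q := fun q hq => by
    simp only [A]
    rw [Finset.sum_congr rfl fun r hr => max_eq_right
      (hw ((Finset.mem_range.1 hr).le.trans hq))]
    simp [mul_comm]
  have hA2 : ∀ q, n ≤ q → A q = w n * n + ((q : ℝ) ^ k - (n : ℝ) ^ k) := fun q hq => by
    rw [← hA1 n le_rfl, ← hsumw, ← hsumw, ← Finset.sum_Ico_eq_sub _ hq]
    simp only [A]
    rw [← Finset.sum_range_add_sum_Ico _ hq]
    congr 1
    exact Finset.sum_congr rfl fun r hr => max_eq_left (hw (Finset.mem_Ico.1 hr).1)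
  have hterm : ∀ j s, A (q j) - ∑ t ∈ Finset.range n with s ≤ t ∧ t < s + q j, D t
      ≤ ((s : ℝ) + q j) ^ k - (s : ℝ) ^ k := by
    intro j s
    have e1 : ∑ t ∈ Finset.range n with s ≤ t ∧ t < s + q j, D t
        = ∑ r ∈ Finset.range (q j), D (s + r) := by
      have : ∑ r ∈ Finset.range (q j), D (s + r) = ∑ t ∈ Finset.Ico s (s + q j), D t := by
        rw [Finset.sum_Ico_eq_sum_range, Nat.add_sub_cancel_left]
      rw [this]
      refine Finset.sum_subset (fun t ht => ?_) fun t ht ht' => hDn t ?_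
      · simp only [Finset.mem_filter] at ht
        exact Finset.mem_Ico.2 ht.2
      · simp only [Finset.mem_Ico, Finset.mem_filter, Finset.mem_range] at ht ht'
        by_contra hcon
        exact ht' ⟨not_le.1 hcon, ht⟩
    rw [e1, ← sum_rpow_increment, sub_le_iff_le_add, ← Finset.sum_add_distrib]
    refine Finset.sum_le_sum fun r _ => ?_
    have : w r ≤ w (s + r) := hw (Nat.le_add_left _ _)
    simp only [D]
    change max (w r) (w n) ≤ w (s + r) + (max (w (s + r)) (w n) - w (s + r))
    rw [add_sub_cancel]
    exact max_le_max_right _ this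
  have hocc : ∑ j, ∑ s ∈ Finset.range T,
      (∑ t ∈ Finset.range n with s ≤ t ∧ t < s + q j, D t) * x j s
        ≤ w n * n - (n : ℝ) ^ k := by
    have e1 : ∑ j, ∑ s ∈ Finset.range T,
        (∑ t ∈ Finset.range n with s ≤ t ∧ t < s + q j, D t) * x j s
        = ∑ t ∈ Finset.range n, D t *
          ∑ j, ∑ s ∈ Finset.range T with s ≤ t ∧ t < s + q j, x j s := by
      simp_rw [Finset.mul_sum, Finset.sum_filter, Finset.sum_mul]
      rw [Finset.sum_comm (s := Finset.range n)]
      refine Finset.sum_congr rfl fun j _ => ?_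
      rw [Finset.sum_comm]
      refine Finset.sum_congr rfl fun t _ => Finset.sum_congr rfl fun s _ => ?_
      split_ifs <;> simp
    have e2 : w n * n - (n : ℝ) ^ k = ∑ t ∈ Finset.range n, D t := by
      rw [← hA1 n le_rfl, ← hsumw]
      simp only [A, D, Finset.sum_sub_distrib]
    rw [e1, e2]
    exact Finset.sum_le_sum fun t _ => mul_le_of_le_one_right (hD0 t) (hcap t)
  have hAsum : ∑ j, X j * A (q j) = w n * v + m * (w n * n - (n : ℝ) ^ k)
      + ∑ j with n < q j, X j * (q j : ℝ) ^ k := by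
    rw [← Finset.sum_filter_add_sum_filter_not Finset.univ (fun j => n < q j), hm, hv,
      Finset.sum_mul, Finset.mul_sum, add_assoc, ← Finset.sum_add_distrib, add_comm]
    congr 1 <;> refine Finset.sum_congr rfl fun j hj => ?_
    · rw [hA1 _ (not_lt.1 (Finset.mem_filter.1 hj).2)]; ring
    · rw [hA2 _ (Finset.mem_filter.1 hj).2.le]; ring
  have hmain : ∑ j, X j * A (q j) - (w n * n - (n : ℝ) ^ k)
      ≤ ∑ j, ∑ s ∈ Finset.range T, (((s : ℝ) + q j) ^ k - (s : ℝ) ^ k) * x j s := by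
    rw [sub_le_iff_le_add]
    refine le_trans ?_ (add_le_add_right hocc _)
    rw [← Finset.sum_add_distrib]
    refine Finset.sum_le_sum fun j _ => ?_
    rw [hX, Finset.sum_mul, ← Finset.sum_add_distrib]
    refine Finset.sum_le_sum fun s _ => ?_
    have := mul_le_mul_of_nonneg_right (hterm j s) (hx j s)
    linarith
  -- The dual value has the chord of `z ^ k` over `[n, n + 1]`, evaluated at `y`, in place of `y ^
  -- k`; convexity puts the chord above.
  have hch := rpow_chord_nat hk hyn hyn1
  have := mul_le_mul_of_nonneg_left hch h1m.le
  rw [hAsum] at hmain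
  refine le_trans ?_ hmain
  rw [← hm]
  have hwv : w n * v = w n * ((1 - m) * y) := by rw [hvy]
  have e3 : w n = ((n : ℝ) + 1) ^ k - (n : ℝ) ^ k := rfl
  rw [← e3] at this
  linarith

set_option linter.unusedSectionVars false

variable {M J : Type*} [Fintype M] [DecidableEq M] [Fintype J] [DecidableEq J]

/-! ### The schedule of an assignment -/

/-- The time at which job `j` starts when each machine processes the jobs that `σ` assigns to it
one after the other. -/
noncomputable def startTime (p : M → J → ℕ∞) (σ : J → M) (j : J) : ℕ :=
  ∑ j' with σ j' = σ j ∧ Fintype.equivFin J j' < Fintype.equivFin J j, (p (σ j) j').toNat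

/-- The integral LP solution of that schedule. -/
noncomputable def scheduleLP (p : M → J → ℕ∞) (σ : J → M) (i : M) (j : J) (s : ℕ) : ℝ :=
  if σ j = i ∧ s = startTime p σ j then 1 else 0

theorem startTime_add_le (p : M → J → ℕ∞) (σ : J → M) {j j' : J} (hσ : σ j = σ j')
    (hlt : Fintype.equivFin J j < Fintype.equivFin J j') :
    startTime p σ j + (p (σ j) j).toNat ≤ startTime p σ j' := by
  unfold startTime
  rw [add_comm, ← Finset.sum_insert (f := fun j' => (p (σ j) j').toNat) (by simp), ← hσ]
  refine Finset.sum_le_sum_of_subset fun l hl => ?_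
  simp only [Finset.mem_insert, Finset.mem_filter, Finset.mem_univ, true_and] at hl ⊢
  rcases hl with rfl | hl
  · exact ⟨rfl, hlt⟩
  · exact ⟨hl.1, hl.2.trans hlt⟩

theorem startTime_add_le_horizon (p : M → J → ℕ∞) (σ : J → M) (j : J) :
    startTime p σ j + (p (σ j) j).toNat ≤ horizon p := by
  unfold startTime horizon
  rw [add_comm, ← Finset.sum_insert (f := fun j' => (p (σ j) j').toNat) (by simp)]
  refine (Finset.sum_le_sum_of_subset (Finset.subset_univ _)).trans
    (Finset.sum_le_sum fun l _ => ?_)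
  exact Finset.le_sup (f := fun i => (p i l).toNat) (Finset.mem_univ (σ j))

theorem toNat_pos_of_ne_top {a : ℕ∞} (h0 : 0 < a) (h : a ≠ ⊤) : 0 < a.toNat := by
  lift a to ℕ using h
  simpa using h0

theorem startTime_lt_horizon {p : M → J → ℕ∞} (hpos : ∀ i j, 0 < p i j) {σ : J → M}
    (hσ : ∀ j, p (σ j) j ≠ ⊤) (j : J) : startTime p σ j < horizon p :=
  lt_of_lt_of_le (Nat.lt_add_of_pos_right (toNat_pos_of_ne_top (hpos _ _) (hσ j)))
    (startTime_add_le_horizon p σ j)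

theorem isLPFeasible_scheduleLP {p : M → J → ℕ∞} (hpos : ∀ i j, 0 < p i j) {σ : J → M}
    (hσ : ∀ j, p (σ j) j ≠ ⊤) : IsLPFeasible p (scheduleLP p σ) where
  mem_Icc i j s := by unfold scheduleLP; split_ifs <;> simp
  covered j := by
    have h := startTime_lt_horizon hpos hσ j
    have h1 : ∀ i s, 0 ≤ scheduleLP p σ i j s := fun i s => by
      unfold scheduleLP; split_ifs <;> simp
    calc (1 : ℝ) = scheduleLP p σ (σ j) j (startTime p σ j) := by simp [scheduleLP]
      _ ≤ ∑ s ∈ Finset.range (horizon p), scheduleLP p σ (σ j) j s :=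
        Finset.single_le_sum (fun s _ => h1 _ s) (Finset.mem_range.2 h)
      _ ≤ _ := Finset.single_le_sum (f := fun i => ∑ s ∈ Finset.range (horizon p),
        scheduleLP p σ i j s) (fun i _ => Finset.sum_nonneg fun s _ => h1 i s)
        (Finset.mem_univ _)
  capacity i t _ := by
    -- The jobs that run on machine `i` at time `t`.
    let A : Finset J := Finset.univ.filter fun j =>
      σ j = i ∧ startTime p σ j ≤ t ∧ t < startTime p σ j + (p (σ j) j).toNat
    have hA : A.card ≤ 1 := by
      rw [Finset.card_le_one]
      intro a ha b hb
      simp only [A, Finset.mem_filter, Finset.mem_univ, true_and] at ha hb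
      rcases lt_trichotomy (Fintype.equivFin J a) (Fintype.equivFin J b) with h | h | h
      · have := startTime_add_le p σ (ha.1.trans hb.1.symm) h
        omega
      · exact (Fintype.equivFin J).injective h
      · have := startTime_add_le p σ (hb.1.trans ha.1.symm) h
        omega
    calc _ ≤ ∑ j, if j ∈ A then (1 : ℝ) else 0 := by
          refine Finset.sum_le_sum fun j _ => ?_
          simp only [scheduleLP, A, Finset.mem_filter, Finset.mem_univ, true_and]
          by_cases hj : σ j = i
          · simp only [hj, true_and, Finset.sum_ite_eq', Finset.mem_filter, Finset.mem_range]
            have hf := hσ j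
            rw [hj] at hf
            lift p i j to ℕ using hf with n hn
            simp only [ENat.toNat_natCast]
            norm_cast
            by_cases h : startTime p σ j ≤ t ∧ t < startTime p σ j + n
            · rw [if_pos h]; split_ifs
              · exact le_rfl
              · exact zero_le_one
            · rw [if_neg fun h' => h h'.2]; split_ifs; simp
          · simp [hj]
      _ = A.card := by simp
      _ ≤ 1 := by exact_mod_cast hA
  not_late i j s h := by
    unfold scheduleLP
    rw [if_neg]
    rintro ⟨rfl, rfl⟩
    have := startTime_add_le_horizon p σ j
    rw [← ENat.natCast_toNat (hσ j)] at h
    exact absurd h (not_lt.2 (by exact_mod_cast this))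

theorem sum_filter_le_sub (p : M → J → ℕ∞) (σ : J → M) (j : J) :
    ∑ j' with Fintype.equivFin J j' ≤ Fintype.equivFin J j,
      (if σ j' = σ j then ((p (σ j) j').toNat : ℝ) else 0)
      = startTime p σ j + (p (σ j) j).toNat := by
  unfold startTime
  rw [Nat.cast_sum, add_comm, ← Finset.sum_insert (f := fun j' => ((p (σ j) j').toNat : ℝ))
    (by simp), ← Finset.sum_filter, Finset.filter_filter]
  refine Finset.sum_congr ?_ fun _ _ => rfl
  ext l
  simp only [Finset.mem_insert, Finset.mem_filter, Finset.mem_univ, true_and]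
  rw [le_iff_lt_or_eq, (Fintype.equivFin J).injective.eq_iff]
  constructor
  · rintro ⟨h | h, h'⟩
    · exact Or.inr ⟨h', h⟩
    · exact Or.inl h
  · rintro (rfl | ⟨h, h'⟩)
    · exact ⟨Or.inr rfl, rfl⟩
    · exact ⟨Or.inl h', h⟩

/-- Each job starts where its predecessor on the machine ends, so the costs telescope to the `k`-th
power of the load. -/
theorem lpCost_scheduleLP {k : ℝ} (hk : 1 ≤ k) {p : M → J → ℕ∞} (hpos : ∀ i j, 0 < p i j)
    {σ : J → M} (hσ : ∀ j, p (σ j) j ≠ ⊤) :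
    lpCost k p (scheduleLP p σ) = ∑ i, (∑ j with σ j = i, ((p i j).toNat : ℝ)) ^ k := by
  have e1 : ∀ j, ∑ i, ∑ s ∈ Finset.range (horizon p),
      (((s : ℝ) + ((p i j).toNat : ℝ)) ^ k - (s : ℝ) ^ k) * scheduleLP p σ i j s
      = ((startTime p σ j : ℝ) + ((p (σ j) j).toNat : ℝ)) ^ k - (startTime p σ j : ℝ) ^ k := by
    intro j
    have h := startTime_lt_horizon hpos hσ j
    rw [Finset.sum_eq_single (σ j), Finset.sum_eq_single (startTime p σ j)]
    · simp [scheduleLP]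
    · intro s _ hs; simp [scheduleLP, hs]
    · intro hs; exact absurd (Finset.mem_range.2 h) hs
    · intro i _ hi; simp [scheduleLP, hi.symm]
    · simp
  have hk0 : k ≠ 0 := by linarith
  unfold lpCost
  rw [Finset.sum_congr rfl fun j _ => e1 j]
  have e2 : ∀ i, (∑ j with σ j = i, ((p i j).toNat : ℝ)) ^ k
      = ∑ j, if σ j = i then
        ((startTime p σ j : ℝ) + ((p (σ j) j).toNat : ℝ)) ^ k - (startTime p σ j : ℝ) ^ k
        else 0 := by
    intro i
    have := sum_prefix_telescope (Fintype.equivFin J).injective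
      (fun j => if σ j = i then ((p i j).toNat : ℝ) else 0) (fun z => z ^ k) Finset.univ
    rw [Real.zero_rpow hk0, sub_zero, ← Finset.sum_filter] at this
    rw [← this]
    refine Finset.sum_congr rfl fun j _ => ?_
    split_ifs with hj
    · subst hj
      rw [sum_filter_le_sub, add_sub_cancel_right]
    · simp
  rw [Finset.sum_congr rfl fun i _ => e2 i, Finset.sum_comm]
  simp

/-! ### Optimum solutions of the LP -/

theorem isClosed_setOf_isLPFeasible (p : M → J → ℕ∞) :
    IsClosed {x : M → J → ℕ → ℝ | IsLPFeasible p x} := by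
  have : {x : M → J → ℕ → ℝ | IsLPFeasible p x} =
      {x | ∀ i j s, x i j s ∈ Set.Icc (0 : ℝ) 1} ∩
      {x | ∀ j, 1 ≤ ∑ i, ∑ s ∈ Finset.range (horizon p), x i j s} ∩
      {x | ∀ i, ∀ t ∈ Finset.range (horizon p),
        ∑ j, ∑ s ∈ Finset.range (horizon p) with s ≤ t ∧ (t : ℕ∞) < s + p i j, x i j s ≤ 1} ∩
      {x | ∀ i j (s : ℕ), (horizon p : ℕ∞) < s + p i j → x i j s = 0} := by
    ext x
    exact ⟨fun h => ⟨⟨⟨h.1, h.2⟩, h.3⟩, h.4⟩, fun h => ⟨h.1.1.1, h.1.1.2, h.1.2, h.2⟩⟩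
  rw [this]
  have hx : ∀ i j s, Continuous fun x : M → J → ℕ → ℝ => x i j s := fun i j s => by fun_prop
  refine ((IsClosed.inter ?_ ?_).inter ?_).inter ?_
  · simp only [Set.ofPred_forall]
    exact isClosed_iInter fun i => isClosed_iInter fun j => isClosed_iInter fun s =>
      isClosed_Icc.preimage (hx i j s)
  · simp only [Set.ofPred_forall]
    exact isClosed_iInter fun j => isClosed_le continuous_const (by fun_prop)
  · simp only [Set.ofPred_forall]
    exact isClosed_iInter fun i => isClosed_iInter fun t => isClosed_iInter fun _ =>
      isClosed_le (by fun_prop) continuous_const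
  · simp only [Set.ofPred_forall]
    exact isClosed_iInter fun i => isClosed_iInter fun j => isClosed_iInter fun s =>
      isClosed_iInter fun _ => isClosed_eq (hx i j s) continuous_const

/-- The feasible set is closed in a product of unit intervals, hence compact by Tychonoff, and the
objective is continuous. -/
theorem exists_isLPOptimal (k : ℝ) {p : M → J → ℕ∞} (hpos : ∀ i j, 0 < p i j)
    (hfin : ∀ j, ∃ i, p i j ≠ ⊤) : ∃ x, IsLPOptimal k p x := by
  choose σ hσ using hfin
  have hK : IsCompact {x : M → J → ℕ → ℝ | IsLPFeasible p x} := by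
    refine IsCompact.of_isClosed_subset (isCompact_univ_pi fun i : M =>
      isCompact_univ_pi fun j : J => isCompact_univ_pi fun s : ℕ =>
        isCompact_Icc (a := (0 : ℝ)) (b := 1)) (isClosed_setOf_isLPFeasible p) ?_
    intro x hx i _ j _ s _
    exact hx.mem_Icc i j s
  obtain ⟨x, hx, hmin⟩ := hK.exists_isMinOn ⟨_, isLPFeasible_scheduleLP hpos hσ⟩
    (f := lpCost k p) (by unfold lpCost; fun_prop)
  exact ⟨x, hx, fun x' hx' => hmin hx'⟩

theorem IsLPFeasible.nonneg {p : M → J → ℕ∞} {x : M → J → ℕ → ℝ} (hx : IsLPFeasible p x)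
    (i : M) (j : J) (s : ℕ) : 0 ≤ x i j s :=
  (hx.mem_Icc i j s).1

theorem IsLPFeasible.eq_zero_of_top {p : M → J → ℕ∞} {x : M → J → ℕ → ℝ}
    (hx : IsLPFeasible p x) {i : M} {j : J} (h : p i j = ⊤) (s : ℕ) : x i j s = 0 :=
  hx.not_late i j s (by simp [h])

theorem IsLPFeasible.frac_nonneg {p : M → J → ℕ∞} {x : M → J → ℕ → ℝ} (hx : IsLPFeasible p x)
    (i : M) (j : J) : 0 ≤ frac p x i j :=
  Finset.sum_nonneg fun s _ => hx.nonneg i j s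

theorem IsLPFeasible.ne_top_of_frac_pos {p : M → J → ℕ∞} {x : M → J → ℕ → ℝ}
    (hx : IsLPFeasible p x) {i : M} {j : J} (h : 0 < frac p x i j) : p i j ≠ ⊤ := fun ht => by
  simp [frac, hx.eq_zero_of_top ht] at h

/-- In an optimum solution no job is processed to a total fraction above one. -/
theorem IsLPOptimal.sum_frac {k : ℝ} (hk : 1 ≤ k) {p : M → J → ℕ∞} (hpos : ∀ i j, 0 < p i j)
    {x : M → J → ℕ → ℝ} (hx : IsLPOptimal k p x) (j : J) : ∑ i, frac p x i j = 1 := by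
  have hf := hx.1
  let S : J → ℝ := fun j => ∑ i, frac p x i j
  have hS : ∀ j, 1 ≤ S j := hf.covered
  have hS0 : ∀ j, 0 < S j := fun j => lt_of_lt_of_le one_pos (hS j)
  -- Scaling each job down to total fraction one stays feasible. As each job has positive cost, this
  -- would be strictly cheaper if some `S j > 1`.
  let r : J → ℝ := fun j => (S j)⁻¹
  have hr0 : ∀ j, 0 ≤ r j := fun j => (inv_pos.2 (hS0 j)).le
  have hr1 : ∀ j, r j ≤ 1 := fun j => inv_le_one_of_one_le₀ (hS j)
  let C : J → ℝ := fun j => ∑ i, ∑ s ∈ Finset.range (horizon p),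
    (((s : ℝ) + ((p i j).toNat : ℝ)) ^ k - (s : ℝ) ^ k) * x i j s
  have hcoef : ∀ i j (s : ℕ), 0 ≤ ((s : ℝ) + ((p i j).toNat : ℝ)) ^ k - (s : ℝ) ^ k :=
    fun i j s => sub_nonneg.2 (Real.rpow_le_rpow (by positivity)
      (le_add_of_nonneg_right (by positivity)) (by linarith))
  have hterm : ∀ i j (s : ℕ), 0 ≤ (((s : ℝ) + ((p i j).toNat : ℝ)) ^ k - (s : ℝ) ^ k) * x i j s :=
    fun i j s => mul_nonneg (hcoef i j s) (hf.nonneg i j s)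
  have hC : ∀ j, 0 < C j := by
    intro j
    obtain ⟨i, -, hi⟩ := Finset.exists_ne_zero_of_sum_ne_zero (hS0 j).ne'
    obtain ⟨s, hs, hxs⟩ := Finset.exists_ne_zero_of_sum_ne_zero hi
    have hp : p i j ≠ ⊤ := fun h => hxs (hf.eq_zero_of_top h s)
    have hq : (0 : ℝ) < (p i j).toNat := by exact_mod_cast toNat_pos_of_ne_top (hpos i j) hp
    refine Finset.sum_pos' (fun i _ => Finset.sum_nonneg fun s _ => hterm i j s)
      ⟨i, Finset.mem_univ _, Finset.sum_pos' (fun s _ => hterm i j s) ⟨s, hs, ?_⟩⟩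
    refine mul_pos (sub_pos.2 (Real.rpow_lt_rpow (by positivity) (by linarith) (by linarith)))
      (lt_of_le_of_ne (hf.nonneg i j s) hxs.symm)
  have hfeas : IsLPFeasible p fun i j s => r j * x i j s := by
    refine ⟨fun i j s => ⟨mul_nonneg (hr0 j) (hf.nonneg i j s),
      mul_le_one₀ (hr1 j) (hf.nonneg i j s) (hf.mem_Icc i j s).2⟩, fun j => ?_,
      fun i t ht => le_trans ?_ (hf.capacity i t ht),
      fun i j s h => by rw [hf.not_late i j s h, mul_zero]⟩
    · simp_rw [← Finset.mul_sum]
      exact (inv_mul_cancel₀ (hS0 j).ne').ge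
    · exact Finset.sum_le_sum fun j _ => Finset.sum_le_sum fun s _ =>
        mul_le_of_le_one_left (hf.nonneg i j s) (hr1 j)
  have hle : ∑ j, C j ≤ ∑ j, r j * C j := by
    refine (hx.2 _ hfeas).trans_eq ?_
    simp only [lpCost, C, Finset.mul_sum]
    exact Finset.sum_congr rfl fun j _ => Finset.sum_congr rfl fun i _ =>
      Finset.sum_congr rfl fun s _ => by ring
  have hle' : ∀ j ∈ Finset.univ, r j * C j ≤ C j := fun j _ =>
    mul_le_of_le_one_left (hC j).le (hr1 j)
  have heq := (Finset.sum_eq_sum_iff_of_le hle').1 ((Finset.sum_le_sum hle').antisymm hle) j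
    (Finset.mem_univ j)
  have hrj : r j = 1 := mul_right_cancel₀ (hC j).ne' (heq.trans (one_mul _).symm)
  exact inv_eq_one.1 hrj

/-- The capacity constraint at all times, with processing times in `ℕ`. -/
theorem IsLPFeasible.capacity_toNat {p : M → J → ℕ∞} {x : M → J → ℕ → ℝ}
    (hx : IsLPFeasible p x) (i : M) (t : ℕ) :
    ∑ j, ∑ s ∈ Finset.range (horizon p) with s ≤ t ∧ t < s + (p i j).toNat, x i j s ≤ 1 := by
  by_cases ht : t ∈ Finset.range (horizon p)
  · refine le_trans (Finset.sum_le_sum fun j _ => ?_) (hx.capacity i t ht)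
    refine Finset.sum_le_sum_of_subset_of_nonneg (fun s hs => ?_) fun s _ _ => hx.nonneg i j s
    simp only [Finset.mem_filter] at hs ⊢
    refine ⟨hs.1, hs.2.1, lt_of_lt_of_le (b := ((s + (p i j).toNat : ℕ) : ℕ∞)) ?_ ?_⟩
    · exact_mod_cast hs.2.2
    · push_cast
      gcongr
      exact ENat.natCast_toNat_le_self _
  -- A job occupying a time beyond the horizon would finish late, so its variable vanishes.
  · refine le_trans (Finset.sum_nonpos fun j _ => Finset.sum_nonpos fun s hs => ?_) zero_le_one
    simp only [Finset.mem_filter, Finset.mem_range, not_lt] at hs ht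
    refine (hx.not_late i j s (lt_of_lt_of_le (b := ((s + (p i j).toNat : ℕ) : ℕ∞)) ?_ ?_)).le
    · exact_mod_cast ht.trans_lt hs.2.2
    · push_cast
      gcongr
      exact ENat.natCast_toNat_le_self _

/-! ### The bucket matching -/

/-- Writes the overlap with a bucket as a difference of one clamp function at two endpoints, ready
to telescope over jobs. -/
theorem max_zero_min_sub_max {X x b : ℝ} (hx : 0 ≤ x) :
    max 0 (min X (b + 1) - max (X - x) b)
      = max b (min X (b + 1)) - max b (min (X - x) (b + 1)) := by
  simp only [max_def, min_def]
  split_ifs <;> linarith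

theorem sum_range_clamp {t : ℝ} (ht : 0 ≤ t) (N : ℕ) :
    ∑ b ∈ Finset.range N, (max (b : ℝ) (min t (b + 1)) - b) = min t N := by
  induction N with
  | zero => simp [ht]
  | succ N ih =>
    rw [Finset.sum_range_succ, ih]
    push_cast
    simp only [max_def, min_def]
    split_ifs <;> linarith

section

variable {p : M → J → ℕ∞} {x : M → J → ℕ → ℝ} {ord : M → J ≃ Fin (Fintype.card J)}

theorem prefixFrac_le_sub (hx : IsLPFeasible p x) {i : M} {j j' : J}
    (h : ord i j' < ord i j) : prefixFrac p x ord i j' ≤ prefixFrac p x ord i j - frac p x i j := by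
  unfold prefixFrac
  rw [le_sub_iff_add_le, add_comm, ← Finset.sum_insert (by simp [h])]
  refine Finset.sum_le_sum_of_subset_of_nonneg (fun l hl => ?_) fun l _ _ => hx.frac_nonneg i l
  simp only [Finset.mem_insert, Finset.mem_filter, Finset.mem_univ, true_and] at hl ⊢
  rcases hl with rfl | hl
  · exact le_rfl
  · exact hl.trans h.le

theorem prefixFrac_sub_nonneg (hx : IsLPFeasible p x) (i : M) (j : J) :
    0 ≤ prefixFrac p x ord i j - frac p x i j :=
  sub_nonneg.2 (Finset.single_le_sum (f := fun j => frac p x i j)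
    (fun l _ => hx.frac_nonneg i l) (by simp))

theorem prefixFrac_le_sum (hx : IsLPFeasible p x) (i : M) (j : J) :
    prefixFrac p x ord i j ≤ ∑ l, frac p x i l :=
  Finset.sum_le_sum_of_subset_of_nonneg (Finset.subset_univ _) fun l _ _ => hx.frac_nonneg i l

theorem bucketMatching_nonneg (j : J) (i : M) (b : ℕ) : 0 ≤ bucketMatching p x ord j i b :=
  le_max_left _ _

theorem lt_of_bucketMatching_pos {j : J} {i : M} {b : ℕ} (h : 0 < bucketMatching p x ord j i b) :
    0 < frac p x i j ∧ (b : ℝ) < prefixFrac p x ord i j ∧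
      prefixFrac p x ord i j - frac p x i j < b + 1 := by
  unfold bucketMatching at h
  rw [lt_max_iff, sub_pos, max_lt_iff, lt_min_iff, lt_min_iff] at h
  rcases h with h | ⟨⟨h1, h2⟩, h3, -⟩
  · exact absurd h (lt_irrefl 0)
  · exact ⟨by linarith, h3, h2⟩

theorem sum_bucketMatching_jobs (hx : IsLPFeasible p x) (i : M) (b : ℕ) :
    ∑ j, bucketMatching p x ord j i b = max (b : ℝ) (min (∑ j, frac p x i j) (b + 1)) - b := by
  have h := sum_prefix_telescope (ord i).injective (fun j => frac p x i j)
    (fun t => max (b : ℝ) (min t (b + 1))) Finset.univ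
  have e : max (b : ℝ) (min 0 (b + 1)) = b := by
    rw [min_eq_left (by positivity), max_eq_left (by positivity)]
  rw [e] at h
  rw [← h]
  exact Finset.sum_congr rfl fun j _ => max_zero_min_sub_max (hx.frac_nonneg i j)

theorem sum_bucketMatching_jobs_le_one (hx : IsLPFeasible p x) (i : M) (b : ℕ) :
    ∑ j, bucketMatching p x ord j i b ≤ 1 := by
  rw [sum_bucketMatching_jobs hx, sub_le_iff_le_add]
  exact max_le (by linarith) ((min_le_right _ _).trans (by linarith))

theorem sum_bucketMatching_buckets (hx : IsLPFeasible p x) {i : M} {N : ℕ}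
    (hN : ∑ j, frac p x i j ≤ N) (j : J) :
    ∑ b ∈ Finset.range N, bucketMatching p x ord j i b = frac p x i j := by
  have h0 := prefixFrac_sub_nonneg (ord := ord) hx i j
  have hx0 := hx.frac_nonneg i j
  have hXN := (prefixFrac_le_sum (ord := ord) hx i j).trans hN
  have h1 := sum_range_clamp h0 N
  have h2 := sum_range_clamp (show 0 ≤ prefixFrac p x ord i j by linarith) N
  rw [min_eq_left (by linarith)] at h1 h2
  have : ∀ b ∈ Finset.range N, bucketMatching p x ord j i b
      = (max (b : ℝ) (min (prefixFrac p x ord i j) (b + 1)) - b)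
        - (max (b : ℝ) (min (prefixFrac p x ord i j - frac p x i j) (b + 1)) - b) := fun b _ => by
    unfold bucketMatching
    rw [max_zero_min_sub_max hx0]; ring
  rw [Finset.sum_congr rfl this, Finset.sum_sub_distrib, h1, h2]
  ring

theorem bucketMatching_eq_zero (hx : IsLPFeasible p x) {i : M} {b : ℕ}
    (hb : ∑ j, frac p x i j ≤ b) (j : J) : bucketMatching p x ord j i b = 0 := by
  refine le_antisymm (not_lt.1 fun h => ?_) (bucketMatching_nonneg j i b)
  exact absurd ((lt_of_bucketMatching_pos h).2.1) (not_lt.2 ((prefixFrac_le_sum hx i j).trans hb))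

/-- If a bucket is used then the previous bucket is full. -/
theorem sum_bucketMatching_jobs_eq_one (hx : IsLPFeasible p x) {i : M} {b : ℕ} {j : J}
    (h : 0 < bucketMatching p x ord j i (b + 1)) : ∑ j, bucketMatching p x ord j i b = 1 := by
  have h1 := (lt_of_bucketMatching_pos h).2.1
  push_cast at h1
  rw [sum_bucketMatching_jobs hx, min_eq_right (h1.le.trans (prefixFrac_le_sum hx i j)),
    max_eq_right (by linarith)]
  ring

/-- Jobs in a bucket are at most as large as jobs in the previous bucket. -/
theorem size_le_of_bucketMatching_pos (hx : IsLPFeasible p x) (hord : IsSizeOrder p ord) {i : M}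
    {b : ℕ} {j j' : J} (h : 0 < bucketMatching p x ord j i b)
    (h' : 0 < bucketMatching p x ord j' i (b + 1)) : p i j' ≤ p i j := by
  by_contra! hcon
  have h1 := prefixFrac_le_sub hx (hord i j' j hcon)
  have h2 := (lt_of_bucketMatching_pos h).2.2
  have h3 := (lt_of_bucketMatching_pos h').2.1
  push_cast at h3
  linarith

/-- A job reaching past bucket 0 has prefix mass above one, all of it from jobs at least as large.
Hence jobs above the critical level, of total mass below one, lie in bucket 0 only. -/
theorem one_lt_sum_frac_of_bucketMatching_pos (hx : IsLPFeasible p x) (hord : IsSizeOrder p ord)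
    {i : M} {b : ℕ} {j : J} (h : 0 < bucketMatching p x ord j i (b + 1)) :
    1 < ∑ j' with p i j ≤ p i j', frac p x i j' := by
  have h1 := (lt_of_bucketMatching_pos h).2.1
  push_cast at h1
  have hb : (0 : ℝ) ≤ b := Nat.cast_nonneg b
  refine lt_of_lt_of_le (b := prefixFrac p x ord i j) (by linarith) ?_
  refine Finset.sum_le_sum_of_subset_of_nonneg (fun l hl => ?_) fun l _ _ => hx.frac_nonneg i l
  simp only [Finset.mem_filter, Finset.mem_univ, true_and] at hl ⊢
  by_contra! hcon
  exact absurd (hord i j l hcon) (not_lt.2 hl)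

end

/-! ### Decomposition into integral matchings -/

/-- A fractional matching that covers the left side is a convex combination of injective maps. -/
theorem mem_convexHull_matchings {B : Type*} [Fintype B] [DecidableEq B] {y : J × B → ℝ}
    (hy : ∀ a, 0 ≤ y a) (hrow : ∀ j, ∑ b, y (j, b) = 1) (hcol : ∀ b, ∑ j, y (j, b) ≤ 1) :
    y ∈ convexHull ℝ {z : J × B → ℝ | ∃ f : J → B, Function.Injective f ∧
      z = fun a => if f a.1 = a.2 then 1 else 0} := by
  -- Pad `y` to a symmetric doubly stochastic matrix, with the slacks of the buckets on the
  -- diagonal, and apply Birkhoff. The zero block forces every permutation of nonzero weight to map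
  -- `J` into `B`.
  let A : Matrix (J ⊕ B) (J ⊕ B) ℝ := Matrix.fromBlocks 0 (Matrix.of fun j b => y (j, b))
    (Matrix.of fun b j => y (j, b)) (Matrix.diagonal fun b => 1 - ∑ j, y (j, b))
  have hA : A ∈ doublyStochastic ℝ (J ⊕ B) := by
    rw [mem_doublyStochastic_iff_sum]
    refine ⟨?_, ?_, ?_⟩
    · rintro (a | a) (b | b)
      · simp [A]
      · simpa [A] using hy _
      · simpa [A] using hy _
      · simp only [A, Matrix.fromBlocks_apply₂₂, Matrix.diagonal_apply]
        split_ifs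
        · linarith [hcol a]
        · exact le_rfl
    · rintro (a | a)
      · simp [A, hrow]
      · simp [A, Matrix.diagonal_apply]
    · rintro (a | a)
      · simp [A, hrow]
      · simp [A, Matrix.diagonal_apply]
  obtain ⟨w, hw0, hw1, hw⟩ := exists_eq_sum_perm_of_mem_doublyStochastic hA
  have hent : ∀ a b, ∑ σ : Equiv.Perm (J ⊕ B), w σ * (if σ a = b then 1 else 0) = A a b := by
    intro a b
    rw [← hw, Matrix.sum_apply]
    refine Finset.sum_congr rfl fun σ _ => ?_
    simp [Equiv.Perm.permMatrix, PEquiv.toMatrix_apply, Equiv.toPEquiv_apply, eq_comm]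
  have hinr : ∀ σ, w σ ≠ 0 → ∀ j, ∃ b, σ (Sum.inl j) = Sum.inr b := by
    intro σ hσ j
    rcases hj : σ (Sum.inl j) with j' | b
    · have h0 := hent (Sum.inl j) (Sum.inl j')
      simp only [A, Matrix.fromBlocks_apply₁₁, Matrix.zero_apply] at h0
      have := (Finset.sum_eq_zero_iff_of_nonneg fun τ _ => mul_nonneg (hw0 τ)
        (by split_ifs <;> norm_num)).1 h0 σ (Finset.mem_univ _)
      simp [hj] at this
      exact absurd this hσ
    · exact ⟨b, rfl⟩
  have hy' : y = ∑ σ with w σ ≠ 0,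
      w σ • fun a : J × B => if σ (Sum.inl a.1) = Sum.inr a.2 then (1 : ℝ) else 0 := by
    ext ⟨j, b⟩
    rw [Finset.sum_apply, Finset.sum_filter_of_ne]
    · have := hent (Sum.inl j) (Sum.inr b)
      simp only [A, Matrix.fromBlocks_apply₁₂, Matrix.of_apply] at this
      simp only [Pi.smul_apply, smul_eq_mul, this]
    · intro σ _ h h0
      simp [h0] at h
  rw [hy']
  refine (convex_convexHull ℝ _).sum_mem (fun σ _ => hw0 σ) ?_ fun σ hσ =>
    subset_convexHull ℝ _ ?_
  · rw [Finset.sum_filter_ne_zero, hw1]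
  · choose f hf using hinr σ (Finset.mem_filter.1 hσ).2
    refine ⟨f, fun a b hab => ?_, ?_⟩
    · exact Sum.inl_injective (σ.injective (by rw [hf, hf, hab]))
    · ext a
      simp [hf]

/-- Carathéodory: the points may be taken affinely independent in dimension `|J| * |B|`. -/
theorem exists_matching_decomposition {B : Type*} [Fintype B] [DecidableEq B] {y : J × B → ℝ}
    (hy : ∀ a, 0 ≤ y a) (hrow : ∀ j, ∑ b, y (j, b) = 1) (hcol : ∀ b, ∑ j, y (j, b) ≤ 1) :
    ∃ r ≤ Fintype.card J * Fintype.card B + 1, ∃ (c : Fin r → ℝ≥0) (f : Fin r → J → B),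
      ∑ a, c a = 1 ∧ (∀ a, Function.Injective (f a)) ∧
      ∀ j b, ∑ a with f a j = b, (c a : ℝ) = y (j, b) := by
  obtain ⟨ι, _, z, w, hz, haff, hw0, hw1, hwz⟩ :=
    eq_pos_convex_span_of_mem_convexHull (mem_convexHull_matchings hy hrow hcol)
  have hcard : Fintype.card ι ≤ Fintype.card J * Fintype.card B + 1 := by
    have := haff.card_le_finrank_succ
    refine this.trans (Nat.succ_le_succ ((Submodule.finrank_le _).trans ?_))
    rw [Module.finrank_fintype_fun_eq_card, Fintype.card_prod]
  choose f hf hzf using fun i => hz (Set.mem_range_self i)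
  let e := (Fintype.equivFin ι).symm
  refine ⟨_, hcard, fun a => (w (e a)).toNNReal, fun a => f (e a), ?_, fun a => hf _,
    fun j b => ?_⟩
  · rw [← NNReal.coe_inj, NNReal.coe_sum, NNReal.coe_one, ← hw1, ← e.sum_comp]
    exact Finset.sum_congr rfl fun a _ => Real.coe_toNNReal _ (hw0 _).le
  · rw [← hwz, Finset.sum_apply, ← e.sum_comp, Finset.sum_filter]
    refine Finset.sum_congr rfl fun a _ => ?_
    rw [Real.coe_toNNReal _ (hw0 _).le, hzf]
    simp

theorem exists_isMatchingDecomposition {k : ℝ} (hk : 1 ≤ k) {p : M → J → ℕ∞}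
    (hpos : ∀ i j, 0 < p i j) {x : M → J → ℕ → ℝ} (hopt : IsLPOptimal k p x)
    (ord : M → J ≃ Fin (Fintype.card J)) :
    ∃ r ≤ (Fintype.card M + Fintype.card J) ^ 2 + 1,
      ∃ (c : Fin r → ℝ≥0) (μ : Fin r → J → M × ℕ),
        IsMatchingDecomposition (bucketMatching p x ord) c μ := by
  have hx := hopt.1
  let N : M → ℕ := fun i => ⌈∑ j, frac p x i j⌉₊
  have hN : ∀ i, ∑ j, frac p x i j ≤ N i := fun i => Nat.le_ceil _
  let B := Σ i, Fin (N i)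
  -- The fractions of all machines sum to `|J|`, and rounding up adds at most one bucket per
  -- machine.
  have hB : Fintype.card B ≤ Fintype.card M + Fintype.card J := by
    have h1 : ((Fintype.card B : ℕ) : ℝ) ≤ ∑ i, (∑ j, frac p x i j + 1) := by
      rw [Fintype.card_sigma, Nat.cast_sum]
      refine Finset.sum_le_sum fun i _ => ?_
      rw [Fintype.card_fin]
      exact (Nat.ceil_lt_add_one (Finset.sum_nonneg fun j _ => hx.frac_nonneg i j)).le
    rw [Finset.sum_add_distrib, Finset.sum_comm,
      Finset.sum_congr rfl fun j _ => hopt.sum_frac hk hpos j] at h1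
    simp only [Finset.sum_const, Finset.card_univ, nsmul_eq_mul, mul_one] at h1
    have h2 : Fintype.card B ≤ Fintype.card J + Fintype.card M := by exact_mod_cast h1
    omega
  obtain ⟨r, hr, c, f, hc, hf, hm⟩ := exists_matching_decomposition
    (y := fun a : J × B => bucketMatching p x ord a.1 a.2.1 a.2.2)
    (fun a => bucketMatching_nonneg _ _ _)
    (fun j => by
      rw [Fintype.sum_sigma, ← hopt.sum_frac hk hpos j]
      refine Finset.sum_congr rfl fun i _ => ?_
      rw [← sum_bucketMatching_buckets (ord := ord) hx (hN i) j]
      exact Fin.sum_univ_eq_sum_range (fun b => bucketMatching p x ord j i b) (N i))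
    (fun b => sum_bucketMatching_jobs_le_one hx b.1 b.2)
  refine ⟨r, hr.trans (Nat.succ_le_succ ?_), c, fun a j => ((f a j).1, (f a j).2), hc, ?_, ?_⟩
  · rw [sq]
    exact Nat.mul_le_mul (Nat.le_add_left _ _) hB
  · intro a j j' h
    apply hf a
    simp only [Prod.mk.injEq] at h
    obtain ⟨h1, h2⟩ := h
    generalize f a j = u at h1 h2 ⊢
    generalize f a j' = u' at h1 h2 ⊢
    obtain ⟨i, b⟩ := u
    obtain ⟨i', b'⟩ := u'
    obtain rfl : i = i' := h1
    obtain rfl : b = b' := Fin.ext h2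
    rfl
  · intro j i b
    by_cases hb : b < N i
    · rw [← hm j ⟨i, ⟨b, hb⟩⟩]
      refine Finset.sum_congr (Finset.filter_congr fun a _ => ?_) fun _ _ => rfl
      constructor
      · intro h
        generalize f a j = u at h
        obtain ⟨i', b'⟩ := u
        simp only [Prod.mk.injEq] at h
        obtain ⟨rfl, rfl⟩ := h
        rfl
      · intro h; rw [h]
    · rw [bucketMatching_eq_zero hx ((hN i).trans (by exact_mod_cast not_lt.1 hb)),
        Finset.filter_false_of_mem, Finset.sum_empty]
      intro a _ h
      simp only [Prod.mk.injEq] at h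
      obtain ⟨rfl, rfl⟩ := h
      exact hb (f a j).2.2

/-! ### The upper bound for the rounding on one machine -/

/-- A separable upper bound on the `k`-th power of a load `L₀ + R`, such that it is paid for by
the profile `(w, v)`. -/
theorem exists_load_certificate {ι : Type*} [Fintype ι] [Nonempty ι] {k : ℝ} (hk : 1 ≤ k)
    {w v : ι → ℝ} (hw : ∀ a, 0 ≤ w a) (hv : ∀ a, 0 ≤ v a) (hw1 : ∑ a, w a = 1) {c : ℝ}
    (hc0 : 0 ≤ c) (hc : c ≤ ∑ a, w a * v a) :
    ∃ (H : ℝ → ℝ) (l : ℝ), (∀ z, (∀ a, z ≤ v a) → H z = c ^ k + l * z) ∧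
      (∀ L R, R ≤ c → c ≤ L + R → (L + R) ^ k ≤ H L + l * (R - c)) ∧
      ∑ a, w a * H (v a) - l * c ≤ alpha k * ∑ a, w a * v a ^ k := by
  obtain ⟨a₀, θ, hθ0, hθ1, hP, hP', hθc⟩ := exists_threshold hw hv hc0 hc
  obtain ⟨l, hl, hl1, hl2⟩ := exists_chord hk hc0 (hv a₀)
  -- `H` follows the chord over `[c, c + v a₀]` and then the shifted power. The two agree at `z = v
  -- a₀`, the only value at which `θ` may be fractional.
  refine ⟨fun z => if z ≤ v a₀ then c ^ k + l * z else (z + c) ^ k, l, ?_, ?_, ?_⟩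
  · intro z hz
    exact if_pos (hz a₀)
  · intro L R hR hLR
    dsimp only
    split_ifs with h
    · have := hl1 (L + R) hLR (by linarith)
      linarith
    · have := hl2 (L + R) (L + c) hLR (by linarith) (by linarith [not_le.1 h])
      linarith
  · refine le_trans (le_of_eq ?_) (profile_sum_le hk hw hv hw1 hθ0 hθ1 hP hP' hθc)
    have hterm : ∀ a, w a * (if v a ≤ v a₀ then c ^ k + l * v a else (v a + c) ^ k)
        = w a * θ a * (v a + c) ^ k + (w a - w a * θ a) * c ^ k
          + l * (w a * (1 - θ a) * v a) := by
      intro a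
      rcases lt_trichotomy (v a) (v a₀) with h | h | h
      · have : θ a = 0 := le_antisymm (not_lt.1 fun h' => absurd (hP a h') (not_le.2 h)) (hθ0 a)
        rw [if_pos h.le, this]; ring
      · rw [if_pos h.le, h, add_comm _ c, hl]; ring
      · have : θ a = 1 := le_antisymm (hθ1 a) (not_lt.1 fun h' => absurd (hP' a h') (not_le.2 h))
        rw [if_neg (not_le.2 h), this]; ring
    rw [Finset.sum_congr rfl fun a _ => hterm a, Finset.sum_add_distrib, Finset.sum_add_distrib,
      ← Finset.mul_sum, hθc, ← Finset.sum_mul, Finset.sum_sub_distrib, hw1]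
    ring

/-! ### Bucket loads under a random matching -/

section

variable {p : M → J → ℕ∞} {x : M → J → ℕ → ℝ} {ord : M → J ≃ Fin (Fintype.card J)} {r : ℕ}
  {c : Fin r → ℝ≥0} {μ : Fin r → J → M × ℕ}

theorem filter_eq_empty_or_singleton {B : Type*} [DecidableEq B] {f : J → B}
    (hf : Function.Injective f) (u : B) :
    (Finset.univ.filter fun j => f j = u) = ∅ ∨
      ∃ j, f j = u ∧ (Finset.univ.filter fun j => f j = u) = {j} := by
  by_cases h : ∃ j, f j = u
  · obtain ⟨j, hj⟩ := h
    refine Or.inr ⟨j, hj, ?_⟩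
    ext l
    simp only [Finset.mem_filter, Finset.mem_univ, true_and, Finset.mem_singleton]
    exact ⟨fun hl => hf (hl.trans hj.symm), fun hl => hl ▸ hj⟩
  · push Not at h
    exact Or.inl (Finset.filter_false_of_mem fun j _ => h j)

theorem IsMatchingDecomposition.sum_mul {y : J → M → ℕ → ℝ} (hd : IsMatchingDecomposition y c μ)
    (f : J → ℝ) (i : M) (b : ℕ) :
    ∑ a, (c a : ℝ) * ∑ j with μ a j = (i, b), f j = ∑ j, f j * y j i b := by
  simp_rw [← hd.marginal, Finset.mul_sum, Finset.sum_filter]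
  rw [Finset.sum_comm]
  refine Finset.sum_congr rfl fun j _ => Finset.sum_congr rfl fun a _ => ?_
  split_ifs <;> ring

theorem IsMatchingDecomposition.sum_coe {y : J → M → ℕ → ℝ}
    (hd : IsMatchingDecomposition y c μ) : ∑ a, (c a : ℝ) = 1 := by
  exact_mod_cast hd.sum_eq_one

theorem IsMatchingDecomposition.pos {y : J → M → ℕ → ℝ} (hd : IsMatchingDecomposition y c μ)
    {a : Fin r} (ha : c a ≠ 0) (j : J) : 0 < y j (μ a j).1 (μ a j).2 := by
  rw [← hd.marginal]
  exact Finset.sum_pos' (fun a _ => (c a).coe_nonneg)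
    ⟨a, by simp, NNReal.coe_pos.2 (pos_iff_ne_zero.2 ha)⟩

/-- Every matching of the decomposition uses every full bucket. -/
theorem IsMatchingDecomposition.exists_of_full {y : J → M → ℕ → ℝ}
    (hd : IsMatchingDecomposition y c μ) {i : M} {b : ℕ} (hfull : ∑ j, y j i b = 1) {a : Fin r}
    (ha : c a ≠ 0) : ∃ j, μ a j = (i, b) := by
  by_contra! hcon
  have h1 : ∑ a, (c a : ℝ) * ∑ j with μ a j = (i, b), (1 : ℝ) = 1 := by
    rw [hd.sum_mul]; simpa using hfull
  have h2 : ∑ a, (c a : ℝ) * ∑ j with μ a j = (i, b), (1 : ℝ) < ∑ a, (c a : ℝ) := by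
    refine Finset.sum_lt_sum (fun a' _ => ?_) ⟨a, Finset.mem_univ _, ?_⟩
    · refine mul_le_of_le_one_right (c a').coe_nonneg ?_
      rcases filter_eq_empty_or_singleton (hd.injective a') (i, b) with h | ⟨j, -, h⟩ <;> simp [h]
    · rw [Finset.filter_false_of_mem fun j _ => hcon j, Finset.sum_empty, mul_zero]
      exact NNReal.coe_pos.2 (pos_iff_ne_zero.2 ha)
  rw [h1, hd.sum_coe] at h2
  exact lt_irrefl _ h2

/-- The largest size of a job in a bucket. -/
noncomputable def bucketMax (p : M → J → ℕ∞) (x : M → J → ℕ → ℝ)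
    (ord : M → J ≃ Fin (Fintype.card J)) (i : M) (b : ℕ) : ℕ :=
  (Finset.univ.filter fun j => 0 < bucketMatching p x ord j i b).sup fun j => (p i j).toNat

theorem bucketLoad_le_bucketMax (hd : IsMatchingDecomposition (bucketMatching p x ord) c μ)
    (i : M) (b : ℕ) {a : Fin r} (ha : c a ≠ 0) :
    ∑ j with μ a j = (i, b), ((p i j).toNat : ℝ) ≤ bucketMax p x ord i b := by
  rcases filter_eq_empty_or_singleton (hd.injective a) (i, b) with h | ⟨j, hj, h⟩
  · simp [h]
  · rw [h, Finset.sum_singleton]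
    have := hd.pos ha j
    rw [hj] at this
    exact_mod_cast Finset.le_sup (f := fun j => (p i j).toNat)
      (Finset.mem_filter.2 ⟨Finset.mem_univ j, this⟩)

/-- If bucket `b + 1` is used, then bucket `b` is full, so each matching of positive weight puts a
job there, and by the order that job is at least as large as any in bucket `b + 1`. -/
theorem bucketMax_succ_le_bucketLoad (hx : IsLPFeasible p x) (hord : IsSizeOrder p ord)
    (hd : IsMatchingDecomposition (bucketMatching p x ord) c μ) (i : M) (b : ℕ) {a : Fin r}
    (ha : c a ≠ 0) :
    (bucketMax p x ord i (b + 1) : ℝ) ≤ ∑ j with μ a j = (i, b), ((p i j).toNat : ℝ) := by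
  by_cases hs : (Finset.univ.filter fun j => 0 < bucketMatching p x ord j i (b + 1)).Nonempty
  · obtain ⟨j', hj', hmax⟩ := Finset.exists_mem_eq_sup _ hs fun j => (p i j).toNat
    have hj' := (Finset.mem_filter.1 hj').2
    obtain ⟨j, hj⟩ := hd.exists_of_full (sum_bucketMatching_jobs_eq_one hx hj') ha
    have hpos := hd.pos ha j
    rw [hj] at hpos
    have h1 : (p i j').toNat ≤ (p i j).toNat :=
      ENat.toNat_le_toNat (size_le_of_bucketMatching_pos hx hord hpos hj')
        (hx.ne_top_of_frac_pos (lt_of_bucketMatching_pos hpos).1)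
    unfold bucketMax
    rw [hmax]
    refine le_trans (Nat.cast_le.2 h1) (Finset.single_le_sum
      (f := fun j => ((p i j).toNat : ℝ)) (fun _ _ => Nat.cast_nonneg _) ?_)
    simpa using hj
  · unfold bucketMax
    rw [Finset.not_nonempty_iff_eq_empty.1 hs]
    simpa using Finset.sum_nonneg fun j _ => Nat.cast_nonneg _

/-- The load of a machine is the sum of the loads of its first buckets. -/
theorem sum_bucketLoad (hx : IsLPFeasible p x)
    (hd : IsMatchingDecomposition (bucketMatching p x ord) c μ) {i : M} {N : ℕ}
    (hN : ∑ j, frac p x i j ≤ N) {a : Fin r} (ha : c a ≠ 0) (f : J → ℝ) :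
    ∑ j with (μ a j).1 = i, f j = ∑ b ∈ Finset.range N, ∑ j with μ a j = (i, b), f j := by
  rw [← Finset.sum_fiberwise_of_maps_to (s := Finset.univ.filter fun j => (μ a j).1 = i)
    (t := Finset.range N) (g := fun j => (μ a j).2)]
  · refine Finset.sum_congr rfl fun b _ => Finset.sum_congr ?_ fun _ _ => rfl
    ext j
    simp [Prod.ext_iff]
  · intro j hj
    have hj := (Finset.mem_filter.1 hj).2
    have hpos := hd.pos ha j
    rw [Finset.mem_range]
    by_contra hcon
    rw [hj, bucketMatching_eq_zero hx (hN.trans (Nat.cast_le.2 (not_lt.1 hcon)))] at hpos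
    exact lt_irrefl _ hpos

/-- The expected `k`-th power of the load of machine `i` is at most `α` times its LP cost. -/
theorem sum_load_rpow_le {k : ℝ} (hk : 1 ≤ k) (hx : IsLPFeasible p x) (hord : IsSizeOrder p ord)
    (hd : IsMatchingDecomposition (bucketMatching p x ord) c μ) (i : M) :
    ∑ a, (c a : ℝ) * (∑ j with (μ a j).1 = i, ((p i j).toNat : ℝ)) ^ k
      ≤ alpha k * ∑ j, ∑ s ∈ Finset.range (horizon p),
        (((s : ℝ) + ((p i j).toNat : ℝ)) ^ k - (s : ℝ) ^ k) * x i j s := by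
  obtain ⟨n, Y, hnY, hYn, hm1, hvol, hLB⟩ := exists_machine_lower_bound hk (horizon p)
    (fun j => (p i j).toNat) (fun j s => hx.nonneg i j s) (hx.capacity_toNat i)
    (X := frac p x i) (fun j => rfl)
  set m := ∑ j with n < (p i j).toNat, frac p x i j with hm
  let X : J → ℝ := frac p x i
  let q : J → ℝ := fun j => ((p i j).toNat : ℝ)
  let y : J → ℕ → ℝ := fun j b => bucketMatching p x ord j i b
  let ℓ : Fin r → ℕ → ℝ := fun a b => ∑ j with μ a j = (i, b), q j
  have hX0 : ∀ j, 0 ≤ X j := hx.frac_nonneg i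
  have hY0 : 0 ≤ Y := (Nat.cast_nonneg n).trans hnY
  obtain ⟨N, hN⟩ : ∃ N : ℕ, ∑ j, frac p x i j ≤ N := exists_nat_ge _
  have hN1 : ∑ j, frac p x i j ≤ (N + 1 : ℕ) := hN.trans (Nat.cast_le.2 (Nat.le_succ N))
  have hyX : ∀ j, y j 0 + ∑ b ∈ Finset.range N, y j (b + 1) = X j := fun j => by
    rw [add_comm, ← Finset.sum_range_succ' (fun b => y j b)]
    exact sum_bucketMatching_buckets hx hN1 j
  have hlarge : ∀ j, n < (p i j).toNat → ∀ b, y j (b + 1) = 0 := by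
    intro j hj b
    by_contra hne
    have hpos : 0 < y j (b + 1) :=
      lt_of_le_of_ne (bucketMatching_nonneg _ _ _) (Ne.symm hne)
    have h1 := one_lt_sum_frac_of_bucketMatching_pos hx hord hpos
    refine absurd (h1.trans_le ?_) (not_lt.2 hm1.le)
    rw [hm, Finset.sum_filter, Finset.sum_filter]
    refine Finset.sum_le_sum fun l _ => ?_
    by_cases hl : p i l = ⊤
    · have : frac p x i l = 0 := by simp [frac, hx.eq_zero_of_top hl]
      simp [this]
    · split_ifs with h1 h2
      · exact le_rfl
      · exact absurd (hj.trans_le (ENat.toNat_le_toNat h1 hl)) h2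
      · exact hX0 l
      · exact le_rfl
  set C : ℝ := ∑ b ∈ Finset.range N, (bucketMax p x ord i (b + 1) : ℝ) with hC
  have hC0 : 0 ≤ C := Finset.sum_nonneg fun b _ => Nat.cast_nonneg _
  have hload : ∀ a, c a ≠ 0 → ∑ j with (μ a j).1 = i, q j
      = ℓ a 0 + ∑ b ∈ Finset.range N, ℓ a (b + 1) := fun a ha => by
    rw [sum_bucketLoad hx hd hN1 ha, Finset.sum_range_succ', add_comm]
  have hR : ∀ a, c a ≠ 0 → ∑ b ∈ Finset.range N, ℓ a (b + 1) ≤ C := fun a ha =>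
    Finset.sum_le_sum fun b _ => bucketLoad_le_bucketMax hd i (b + 1) ha
  -- Shift by one: the maximum of each bucket is charged to the load of the bucket before it.
  have hL : ∀ a, c a ≠ 0 → C ≤ ℓ a 0 + ∑ b ∈ Finset.range N, ℓ a (b + 1) := fun a ha => by
    rw [add_comm, ← Finset.sum_range_succ' (fun b => ℓ a b), Finset.sum_range_succ]
    exact (Finset.sum_le_sum fun b _ =>
      bucketMax_succ_le_bucketLoad hx hord hd i b ha).trans
      (le_add_of_nonneg_right (Finset.sum_nonneg fun _ _ => Nat.cast_nonneg _))
  have hER : ∑ a, (c a : ℝ) * ∑ b ∈ Finset.range N, ℓ a (b + 1)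
      = ∑ j, q j * ∑ b ∈ Finset.range N, y j (b + 1) := by
    simp_rw [Finset.mul_sum]
    rw [Finset.sum_comm, Finset.sum_comm (s := Finset.univ)]
    refine Finset.sum_congr rfl fun b _ => ?_
    rw [← hd.sum_mul]
  have hCvol : C ≤ ∑ j, X j * q j := by
    have e1 : C = ∑ a, (c a : ℝ) * C := by rw [← Finset.sum_mul, hd.sum_coe, one_mul]
    have e2 : ∑ j, X j * q j
        = ∑ a, (c a : ℝ) * (ℓ a 0 + ∑ b ∈ Finset.range N, ℓ a (b + 1)) := by
      simp_rw [mul_add]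
      rw [Finset.sum_add_distrib, hER, hd.sum_mul, ← Finset.sum_add_distrib]
      refine Finset.sum_congr rfl fun j _ => ?_
      rw [← mul_add, ← hyX]
      ring
    rw [e1, e2]
    refine Finset.sum_le_sum fun a _ => ?_
    by_cases ha : c a = 0
    · simp [ha]
    · exact mul_le_mul_of_nonneg_left (hL a ha) (c a).coe_nonneg
  -- The profile: `none` is the smeared mass of short jobs. A short `some j` has weight zero and the
  -- dummy value `Y`, so that `Y` is the least value and `H` is affine on `z ≤ Y`.
  let w : Option J → ℝ := fun o => o.elim (1 - m) fun j => if n < (p i j).toNat then X j else 0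
  let v : Option J → ℝ := fun o => o.elim Y fun j => if n < (p i j).toNat then q j else Y
  have hsum : ∀ f : ℝ → ℝ, ∑ o, w o * f (v o)
      = (1 - m) * f Y + ∑ j with n < (p i j).toNat, X j * f (q j) := fun f => by
    rw [Fintype.sum_option, Finset.sum_filter]
    congr 1
    refine Finset.sum_congr rfl fun j _ => ?_
    simp only [w, v, Option.elim_some]
    split_ifs <;> simp
  have hw0 : ∀ o, 0 ≤ w o := by
    rintro (_ | j)
    · simp only [w, Option.elim_none]; linarith
    · simp only [w, Option.elim_some]; split_ifs
      · exact hX0 j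
      · exact le_rfl
  have hvY : ∀ o, Y ≤ v o := by
    rintro (_ | j)
    · exact le_rfl
    · simp only [v, Option.elim_some]; split_ifs with h
      · refine hYn.trans ?_
        have : ((n + 1 : ℕ) : ℝ) ≤ ((p i j).toNat : ℝ) := Nat.cast_le.2 (Nat.succ_le_of_lt h)
        rwa [Nat.cast_succ] at this
      · exact le_rfl
  have hw1 : ∑ o, w o = 1 := by
    have := hsum fun _ => 1
    simp only [mul_one] at this
    rw [this]
    exact sub_add_cancel 1 m
  have hsplit : ∀ f : J → ℝ, ∑ j, f j
      = ∑ j with n < (p i j).toNat, f j + ∑ j with ¬ n < (p i j).toNat, f j := fun f =>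
    (Finset.sum_filter_add_sum_filter_not _ _ _).symm
  have hCw : C ≤ ∑ o, w o * v o := by
    rw [hsum fun z => z, hvol, add_comm]
    exact hCvol.trans_eq (hsplit _)
  obtain ⟨H, l, hH, hpath, hbound⟩ := exists_load_certificate hk hw0
    (fun o => hY0.trans (hvY o)) hw1 hC0 hCw
  have hHsmall : ∀ z, z ≤ Y → H z = C ^ k + l * z := fun z hz => hH z fun o => hz.trans (hvY o)
  have hH0 : H 0 = C ^ k := by rw [hHsmall 0 hY0]; ring
  -- Bucket 0 holds at most one job, so `H` of its load is a sum over jobs, and its expectation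
  -- depends only on the marginals.
  have hHL : ∀ a, H (ℓ a 0) = C ^ k + ∑ j with μ a j = (i, 0), (H (q j) - C ^ k) := by
    intro a
    simp only [ℓ]
    rcases filter_eq_empty_or_singleton (hd.injective a) (i, 0) with h | ⟨j, -, h⟩
    · rw [h]; simp [hH0]
    · rw [h]; simp
  have hstep1 : ∑ a, (c a : ℝ) * (∑ j with (μ a j).1 = i, q j) ^ k
      ≤ ∑ a, (c a : ℝ) * (H (ℓ a 0) + l * (∑ b ∈ Finset.range N, ℓ a (b + 1) - C)) := by
    refine Finset.sum_le_sum fun a _ => ?_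
    by_cases ha : c a = 0
    · simp [ha]
    · rw [hload a ha]
      exact mul_le_mul_of_nonneg_left (hpath _ _ (hR a ha) (hL a ha)) (c a).coe_nonneg
  have hstep2 : ∑ a, (c a : ℝ) * (H (ℓ a 0) + l * (∑ b ∈ Finset.range N, ℓ a (b + 1) - C))
      = C ^ k + ∑ j, ((H (q j) - C ^ k) * y j 0
        + l * (q j * ∑ b ∈ Finset.range N, y j (b + 1))) - l * C := by
    have e : ∀ a, (c a : ℝ) * (H (ℓ a 0) + l * (∑ b ∈ Finset.range N, ℓ a (b + 1) - C))
        = (c a : ℝ) * C ^ k + (c a : ℝ) * ∑ j with μ a j = (i, 0), (H (q j) - C ^ k)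
          + l * ((c a : ℝ) * ∑ b ∈ Finset.range N, ℓ a (b + 1)) - (c a : ℝ) * (l * C) := by
      intro a; rw [hHL]; ring
    rw [Finset.sum_congr rfl fun a _ => e a, Finset.sum_sub_distrib, Finset.sum_add_distrib,
      Finset.sum_add_distrib, ← Finset.sum_mul, ← Finset.sum_mul, hd.sum_coe, ← Finset.mul_sum,
      hER, hd.sum_mul, Finset.sum_add_distrib, ← Finset.mul_sum]
    ring
  have hstep3 : C ^ k + ∑ j, ((H (q j) - C ^ k) * y j 0
        + l * (q j * ∑ b ∈ Finset.range N, y j (b + 1))) - l * C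
      = ∑ o, w o * H (v o) - l * C := by
    rw [hsum, hHsmall Y le_rfl, hsplit]
    have e1 : ∑ j with n < (p i j).toNat, ((H (q j) - C ^ k) * y j 0
        + l * (q j * ∑ b ∈ Finset.range N, y j (b + 1)))
        = ∑ j with n < (p i j).toNat, X j * H (q j) - m * C ^ k := by
      rw [hm, Finset.sum_mul, ← Finset.sum_sub_distrib]
      refine Finset.sum_congr rfl fun j hj => ?_
      have hz : ∑ b ∈ Finset.range N, y j (b + 1) = 0 :=
        Finset.sum_eq_zero fun b _ => hlarge j (Finset.mem_filter.1 hj).2 b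
      have := hyX j
      rw [hz, add_zero] at this
      rw [hz, this]
      ring
    -- Short jobs contribute `l` per unit of volume in whichever bucket they lie, so only their
    -- volume `(1 - m) * Y` counts.
    have e2 : ∑ j with ¬ n < (p i j).toNat, ((H (q j) - C ^ k) * y j 0
        + l * (q j * ∑ b ∈ Finset.range N, y j (b + 1))) = l * ((1 - m) * Y) := by
      rw [hvol, Finset.mul_sum]
      refine Finset.sum_congr rfl fun j hj => ?_
      have hjn : q j ≤ Y :=
        (Nat.cast_le.2 (not_lt.1 (Finset.mem_filter.1 hj).2)).trans hnY
      rw [hHsmall _ hjn]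
      change _ = l * (X j * q j)
      rw [← hyX]
      ring
    rw [e1, e2]
    ring
  refine hstep1.trans (hstep2.trans hstep3 |>.le.trans (hbound.trans ?_))
  refine mul_le_mul_of_nonneg_left ?_ (zero_le_one.trans (one_le_alpha hk))
  rw [hsum fun z => z ^ k, add_comm]
  exact hLB

/-! ### Expectations -/

theorem lkNorm_rpow {k : ℝ} (hk : 1 ≤ k) (p : M → J → ℕ∞) (σ : J → M) :
    lkNorm k p σ ^ k = ∑ i, load p σ i ^ k := by
  have hk0 : k ≠ 0 := by linarith
  unfold lkNorm
  rw [← ENNReal.rpow_mul, one_div_mul_cancel hk0, ENNReal.rpow_one]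

theorem lkNorm_rpow_eq_ofReal {k : ℝ} (hk : 1 ≤ k) {p : M → J → ℕ∞} {σ : J → M}
    (hσ : ∀ j, p (σ j) j ≠ ⊤) :
    lkNorm k p σ ^ k
      = ENNReal.ofReal (∑ i, (∑ j with σ j = i, ((p i j).toNat : ℝ)) ^ k) := by
  have hk0 : 0 ≤ k := by linarith
  rw [lkNorm_rpow hk, ENNReal.ofReal_sum_of_nonneg fun i _ => by positivity]
  refine Finset.sum_congr rfl fun i _ => ?_
  rw [← ENNReal.ofReal_rpow_of_nonneg (by positivity) hk0,
    ENNReal.ofReal_sum_of_nonneg fun j _ => by positivity]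
  congr 1
  unfold load
  refine Finset.sum_congr rfl fun j hj => ?_
  have hf := hσ j
  rw [(Finset.mem_filter.1 hj).2] at hf
  lift p i j to ℕ using hf with n
  simp

theorem lkNorm_eq_top {k : ℝ} (hk : 1 ≤ k) {p : M → J → ℕ∞} {σ : J → M} {j : J}
    (hj : p (σ j) j = ⊤) : lkNorm k p σ = ⊤ := by
  have hk0 : 0 < k := by linarith
  have h1 : load p σ (σ j) = ⊤ := ENNReal.sum_eq_top.2 ⟨j, by simp, by simp [hj]⟩
  have h2 : ∑ i, load p σ i ^ k = ⊤ :=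
    ENNReal.sum_eq_top.2 ⟨σ j, Finset.mem_univ _, by rw [h1, ENNReal.top_rpow_of_pos hk0]⟩
  unfold lkNorm
  rw [h2, ENNReal.top_rpow_of_pos (by positivity)]

theorem expectation_lkNorm_rpow_le {k : ℝ} (hk : 1 ≤ k) (hpos : ∀ i j, 0 < p i j)
    (hopt : IsLPOptimal k p x) (hord : IsSizeOrder p ord)
    (hd : IsMatchingDecomposition (bucketMatching p x ord) c μ) (σ : J → M) :
    expectation c μ (fun τ => lkNorm k p τ ^ k)
      ≤ ENNReal.ofReal (alpha k) * lkNorm k p σ ^ k := by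
  have hα : 0 < alpha k := lt_of_lt_of_le one_pos (one_le_alpha hk)
  have hk0 : 0 < k := by linarith
  by_cases hσ : ∀ j, p (σ j) j ≠ ⊤
  swap
  · push Not at hσ
    obtain ⟨j, hj⟩ := hσ
    rw [lkNorm_eq_top hk hj, ENNReal.top_rpow_of_pos hk0,
      ENNReal.mul_top (ENNReal.ofReal_pos.2 hα).ne']
    exact le_top
  have hx := hopt.1
  let F : Fin r → ℝ := fun a => ∑ i, (∑ j with (μ a j).1 = i, ((p i j).toNat : ℝ)) ^ k
  have hF : ∀ a, 0 ≤ F a := fun a => Finset.sum_nonneg fun i _ => by positivity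
  have e1 : expectation c μ (fun τ => lkNorm k p τ ^ k)
      = ENNReal.ofReal (∑ a, (c a : ℝ) * F a) := by
    rw [ENNReal.ofReal_sum_of_nonneg fun a _ => mul_nonneg (c a).coe_nonneg (hF a)]
    refine Finset.sum_congr rfl fun a _ => ?_
    by_cases ha : c a = 0
    · simp [ha]
    -- A matching of positive weight uses only pairs of positive fraction, so its loads are finite.
    · beta_reduce
      rw [lkNorm_rpow_eq_ofReal hk (σ := toAssignment (μ a)) fun j =>
          hx.ne_top_of_frac_pos (lt_of_bucketMatching_pos (hd.pos ha j)).1,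
        ENNReal.ofReal_mul (c a).coe_nonneg, ENNReal.ofReal_coe_nnreal]
      rfl
  rw [e1, lkNorm_rpow_eq_ofReal hk hσ, ← ENNReal.ofReal_mul hα.le]
  refine ENNReal.ofReal_le_ofReal ?_
  rw [← lpCost_scheduleLP hk hpos hσ]
  refine le_trans ?_ (mul_le_mul_of_nonneg_left (hopt.2 _ (isLPFeasible_scheduleLP hpos hσ)) hα.le)
  unfold lpCost
  rw [Finset.sum_comm (s := Finset.univ) (t := Finset.univ), Finset.mul_sum]
  simp only [F, Finset.mul_sum (Finset.univ : Finset M)]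
  rw [Finset.sum_comm]
  exact Finset.sum_le_sum fun i _ => sum_load_rpow_le hk hx hord hd i

theorem expectation_le_rpow {k : ℝ} (hk : 1 ≤ k) {y : J → M → ℕ → ℝ}
    (hd : IsMatchingDecomposition y c μ) (Z : (J → M) → ℝ≥0∞) :
    expectation c μ Z ≤ expectation c μ (fun τ => Z τ ^ k) ^ (1 / k) := by
  have hk0 : 0 < k := by linarith
  rw [one_div, ENNReal.le_rpow_inv_iff hk0]
  unfold expectation
  exact ENNReal.rpow_arith_mean_le_arith_mean_rpow Finset.univ _ _
    (by exact_mod_cast hd.sum_eq_one) hk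

end

end LkSched

/-! ### The approximation theorem -/

theorem theorem3 {M J : Type*} [Fintype M] [DecidableEq M] [Fintype J] [DecidableEq J]
    (k : ℝ) (hk : 1 ≤ k) (p : M → J → ℕ∞) (hpos : ∀ i j, 0 < p i j)
    (hfin : ∀ j, ∃ i, p i j ≠ ⊤) :
    BddAbove (LkSched.gValues k) ∧
    (∃ x, LkSched.IsLPOptimal k p x) ∧
    ∀ x, LkSched.IsLPOptimal k p x →
      ∀ ord : M → J ≃ Fin (Fintype.card J), LkSched.IsSizeOrder p ord →
        (∃ r ≤ (Fintype.card M + Fintype.card J) ^ 2 + 1,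
          ∃ (c : Fin r → ℝ≥0) (μ : Fin r → J → M × ℕ),
            LkSched.IsMatchingDecomposition (LkSched.bucketMatching p x ord) c μ) ∧
        ∀ (r : ℕ) (c : Fin r → ℝ≥0) (μ : Fin r → J → M × ℕ),
          LkSched.IsMatchingDecomposition (LkSched.bucketMatching p x ord) c μ →
            ∀ σ : J → M,
              LkSched.expectation c μ (fun τ => LkSched.lkNorm k p τ ^ k) ≤
                  ENNReal.ofReal (LkSched.alpha k) * LkSched.lkNorm k p σ ^ k ∧
              LkSched.expectation c μ (fun τ => LkSched.lkNorm k p τ) ≤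
                  ENNReal.ofReal (LkSched.alpha k ^ (1 / k)) * LkSched.lkNorm k p σ := by

  refine ⟨LkSched.bddAbove_gValues hk, LkSched.exists_isLPOptimal k hpos hfin,
    fun x hopt ord hord => ⟨LkSched.exists_isMatchingDecomposition hk hpos hopt ord,
      fun r c μ hd σ => ?_⟩⟩
  have h := LkSched.expectation_lkNorm_rpow_le hk hpos hopt hord hd σ
  refine ⟨h, (LkSched.expectation_le_rpow hk hd _).trans ?_⟩
  have hk0 : 0 < k := by linarith
  have hα : 0 ≤ LkSched.alpha k := zero_le_one.trans (LkSched.one_le_alpha hk)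
  refine (ENNReal.rpow_le_rpow h (by positivity)).trans_eq ?_
  rw [ENNReal.mul_rpow_of_nonneg _ _ (by positivity), ← ENNReal.rpow_mul,
    mul_one_div_cancel hk0.ne', ENNReal.rpow_one,
    ENNReal.ofReal_rpow_of_nonneg hα (by positivity)]
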